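/- Let $\Gamma$ be an abelian group and let $S=\bigoplus_{i\in\Gamma}S_i$ be a commutative $\Gamma$-graded ring which is regular local in the graded sense: $S$ is Noetherian, has a unique maximal homogeneous ideal, and this ideal is generated by a regular sequence of homogeneous elements. (For $\Gamma=\mathbb Z$ these are regular local graded rings; for $\Gamma=0$ they are ordinary regular local rings, graded modules are ordinary modules, and $d=0$ below.) Let $f\in S_d$ be a nonzero element of degree $d$, and let $R=S/(f)$ be the hypersurface ring, with the induced grading. For a graded module $N$ let $\Sigma^dN$ be the graded module with $(\Sigma^dN)_i=N_{i-d}$; let $\mathsf D(R)$ be the derived category of graded $R$-modules, and for a graded $R$-module $M$ write $\Sigma^{d+2}M=(\Sigma^dM)[2]$ in $\mathsf D(R)$. Let $M$ be a finitely generated graded $R$-module. Choose a graded free $S$-module $F$ with a degree-preserving $S$-linear epimorphism $\pi\colon F\to M$, and let $K=\ker\pi$. Then the sequence of graded $R$-modules $$0\longrightarrow \Sigma^dM\longrightarrow K/fK\longrightarrow F/fF\longrightarrow M\longrightarrow 0$$ is exact, where the first map sends $\pi(x)$ to the class of $fx$ (so that $\Sigma^dM\cong\operatorname{Tor}_1^S(R,M)$)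 and the other maps are induced by $K\subseteq F$ and by $\pi$. Let $$\chi_f\colon M\longrightarrow\Sigma^{d+2}M$$ be the morphism of $\mathsf D(R)$ given by its class in $\operatorname{Ext}^2_R(M,\Sigma^dM)$. Then the mapping cone $C$ of $\chi_f$ is small in $\mathsf D(R)$, that is, for every set-indexed family $(N_\alpha)$ of objects the natural map $\bigoplus_\alpha\operatorname{Hom}(C,N_\alpha)\to\operatorname{Hom}(C,\bigoplus_\alpha N_\alpha)$ is an isomorphism; and $C$ is perfect, that is, isomorphic in $\mathsf D(R)$ to a bounded complex of finitely generated graded free $R$-modules. -/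

import Mathlib

open CategoryTheory CategoryTheory.Limits

universe w v u t

noncomputable section

/-! ### Graded modules

`A` is a commutative ring with a family `𝒜` of additive subgroups indexed by an abelian group `Γ`
(in use, a grading).  For `Γ = ℤ` we get graded modules in the usual sense, for `Γ` trivial we get
ordinary modules. -/

/-- A `Γ`-graded module over the graded ring `(A, 𝒜)`: a module which is the internal direct sum of
subgroups `deg i`, with `𝒜 i • deg j ⊆ deg (i + j)`. -/
structure GrMod {Γ : Type t} [AddCommGroup Γ] [DecidableEq Γ] {A : Type u} [CommRing A]
    (𝒜 : Γ → AddSubgroup A) where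
  carrier : Type v
  [addCommGroup : AddCommGroup carrier]
  [module : Module A carrier]
  deg : Γ → AddSubgroup carrier
  isInternal : DirectSum.IsInternal deg
  smul_mem : ∀ {i j : Γ} {a : A} {x : carrier}, a ∈ 𝒜 i → x ∈ deg j → a • x ∈ deg (i + j)

/-- Criterion for an internal direct sum through projections. -/
theorem isInternal_of_proj {Γ : Type t} [DecidableEq Γ] {M : Type v} [AddCommGroup M]
    (ℳ : Γ → AddSubgroup M) (p : Γ → M →+ M)
    (h1 : ∀ i x, x ∈ ℳ i → p i x = x) (h2 : ∀ i j x, x ∈ ℳ i → i ≠ j → p j x = 0)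
    (h3 : ∀ x, ∃ s : Finset Γ, ∃ y : Γ → M, (∀ i, y i ∈ ℳ i) ∧ x = ∑ i ∈ s, y i) :
    DirectSum.IsInternal ℳ := by
  constructor
  · have key : ∀ (j : Γ) (z : DirectSum Γ fun i => ℳ i),
        p j (DirectSum.coeAddMonoidHom ℳ z) = (z j : M) := by
      intro j z
      induction z using DirectSum.induction_on with
      | zero => simp
      | of i x =>
        rw [DirectSum.coeAddMonoidHom_of]
        by_cases h : i = j
        · subst h
          rw [h1 _ _ x.2, DirectSum.of_eq_same]
        · rw [h2 i j x x.2 h, DirectSum.of_eq_of_ne _ _ _ (Ne.symm h)]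
          rfl
      | add a b ha hb => simp [map_add, ha, hb]
    intro a b hab
    refine DFinsupp.ext fun j => Subtype.ext ?_
    have ha := key j a
    rw [hab, key j b] at ha
    exact ha.symm
  · intro x
    obtain ⟨s, y, hy, rfl⟩ := h3 x
    refine ⟨∑ i ∈ s, DirectSum.of (fun i => ℳ i) i ⟨y i, hy i⟩, ?_⟩
    simp [map_sum, DirectSum.coeAddMonoidHom_of]

namespace GrMod

section

variable {Γ : Type t} [AddCommGroup Γ] [DecidableEq Γ] {A : Type u} [CommRing A]
  {𝒜 : Γ → AddSubgroup A}

instance : CoeSort (GrMod.{v} 𝒜) (Type v) := ⟨GrMod.carrier⟩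

attribute [instance] GrMod.addCommGroup GrMod.module

/-- The decomposition of a graded module into its components. -/
def decomp (M : GrMod.{v} 𝒜) : (DirectSum Γ fun i => M.deg i) ≃+ M :=
  AddEquiv.ofBijective (DirectSum.coeAddMonoidHom M.deg) (by exact M.isInternal)

theorem decomp_apply (M : GrMod.{v} 𝒜) (z : DirectSum Γ fun i => M.deg i) :
    M.decomp z = DirectSum.coeAddMonoidHom M.deg z := rfl

/-- The projection of a graded module onto its component of degree `i`. -/
def proj (M : GrMod.{v} 𝒜) (i : Γ) : M →+ M where
  toFun x := ((M.decomp.symm x) i : M)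
  map_zero' := by simp
  map_add' := by simp

variable (M : GrMod.{v} 𝒜)

theorem proj_mem (i : Γ) (x : M) : M.proj i x ∈ M.deg i :=
  ((M.decomp.symm x) i).2

theorem symm_of_mem {i : Γ} {x : M} (hx : x ∈ M.deg i) :
    M.decomp.symm x = DirectSum.of (fun i => M.deg i) i ⟨x, hx⟩ := by
  rw [AddEquiv.symm_apply_eq]
  rw [decomp_apply, DirectSum.coeAddMonoidHom_of]

theorem proj_of_mem {i : Γ} {x : M} (hx : x ∈ M.deg i) : M.proj i x = x := by
  change ((M.decomp.symm x) i : M) = x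
  rw [M.symm_of_mem hx, DirectSum.of_eq_same]

theorem proj_of_mem_ne {i j : Γ} {x : M} (hx : x ∈ M.deg i) (h : i ≠ j) : M.proj j x = 0 := by
  change ((M.decomp.symm x) j : M) = 0
  rw [M.symm_of_mem hx, DirectSum.of_eq_of_ne _ _ _ (Ne.symm h)]
  rfl

theorem exists_sum_proj (x : M) : ∃ s : Finset Γ, x = ∑ i ∈ s, M.proj i x := by
  classical
  refine ⟨(M.decomp.symm x).support, ?_⟩
  conv_lhs => rw [← M.decomp.apply_symm_apply x]
  rw [decomp_apply, DirectSum.coeAddMonoidHom_eq_dfinsuppSum, DFinsupp.sum]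
  rfl

/-- Additive maps which agree on homogeneous elements agree. -/
theorem addHom_ext {N : Type*} [AddCommGroup N] {f g : M →+ N}
    (h : ∀ i, ∀ x ∈ M.deg i, f x = g x) : f = g := by
  ext x
  obtain ⟨s, hs⟩ := M.exists_sum_proj x
  rw [hs, map_sum, map_sum]
  exact Finset.sum_congr rfl fun i _ => h i _ (M.proj_mem i x)

/-- Multiplication by a ring element of degree `d` commutes with projections up to a shift. -/
theorem proj_smul {d : Γ} {a : A} (ha : a ∈ 𝒜 d) (i : Γ) (x : M) :
    M.proj i (a • x) = a • M.proj (i - d) x := by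
  have := M.addHom_ext (f := (M.proj i).comp (DistribSMul.toAddMonoidHom M a))
    (g := (DistribSMul.toAddMonoidHom M a).comp (M.proj (i - d))) ?_
  · exact DFunLike.congr_fun this x
  · intro j y hy
    change M.proj i (a • y) = a • M.proj (i - d) y
    have hay := M.smul_mem ha hy
    by_cases h : i = d + j
    · subst h
      rw [M.proj_of_mem hay, add_sub_cancel_left, M.proj_of_mem hy]
    · rw [M.proj_of_mem_ne hay (Ne.symm h), M.proj_of_mem_ne hy, smul_zero]
      rintro rfl
      exact h (by abel)

/-! ### The category of graded modules -/

/-- Morphisms of graded modules: linear maps preserving degrees. -/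
@[ext]
structure Hom (M N : GrMod.{v} 𝒜) where
  lin : M →ₗ[A] N
  map_deg : ∀ {i : Γ} {x : M}, x ∈ M.deg i → lin x ∈ N.deg i

instance : Category (GrMod.{v} 𝒜) where
  Hom := Hom
  id M := ⟨LinearMap.id, fun h => h⟩
  comp f g := ⟨g.lin.comp f.lin, fun h => g.map_deg (f.map_deg h)⟩

variable {M} {N P : GrMod.{v} 𝒜}

@[ext] theorem hom_ext {f g : M ⟶ N} (h : ∀ x, f.lin x = g.lin x) : f = g :=
  Hom.ext (LinearMap.ext h)

@[simp] theorem id_lin : Hom.lin (𝟙 M) = LinearMap.id := rfl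
@[simp] theorem comp_lin (f : M ⟶ N) (g : N ⟶ P) : (f ≫ g).lin = g.lin.comp f.lin := rfl

theorem lin_proj (f : M ⟶ N) (i : Γ) (x : M) : f.lin (M.proj i x) = N.proj i (f.lin x) := by
  have := M.addHom_ext (f := f.lin.toAddMonoidHom.comp (M.proj i))
    (g := (N.proj i).comp f.lin.toAddMonoidHom) ?_
  · exact DFunLike.congr_fun this x
  · intro j y hy
    change f.lin (M.proj i y) = N.proj i (f.lin y)
    by_cases h : j = i
    · subst h
      rw [M.proj_of_mem hy, N.proj_of_mem (f.map_deg hy)]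
    · rw [M.proj_of_mem_ne hy h, N.proj_of_mem_ne (f.map_deg hy) h, map_zero]

instance : Zero (M ⟶ N) := ⟨⟨0, fun _ => zero_mem _⟩⟩
instance : Add (M ⟶ N) := ⟨fun f g => ⟨f.lin + g.lin, fun h => add_mem (f.map_deg h) (g.map_deg h)⟩⟩
instance : Neg (M ⟶ N) := ⟨fun f => ⟨-f.lin, fun h => neg_mem (f.map_deg h)⟩⟩
instance : Sub (M ⟶ N) := ⟨fun f g => ⟨f.lin - g.lin, fun h => sub_mem (f.map_deg h) (g.map_deg h)⟩⟩
instance : SMul ℕ (M ⟶ N) := ⟨fun n f => ⟨n • f.lin, fun h => nsmul_mem (f.map_deg h) n⟩⟩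
instance : SMul ℤ (M ⟶ N) := ⟨fun n f => ⟨n • f.lin, fun h => zsmul_mem (f.map_deg h) n⟩⟩

@[simp] theorem zero_lin : Hom.lin (0 : M ⟶ N) = 0 := rfl
@[simp] theorem add_lin (f g : M ⟶ N) : (f + g).lin = f.lin + g.lin := rfl

instance : AddCommGroup (M ⟶ N) :=
  Function.Injective.addCommGroup (fun f : M ⟶ N => f.lin) (fun _ _ h => Hom.ext h)
    rfl (fun _ _ => rfl) (fun _ => rfl) (fun _ _ => rfl) (fun _ _ => rfl) (fun _ _ => rfl)

instance : Preadditive (GrMod.{v} 𝒜) where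
  add_comp _ _ _ f g h := hom_ext fun x => by simp
  comp_add _ _ _ f g h := hom_ext fun x => by simp

/-- Submodules closed under projections are graded modules. -/
def ofSubmodule (M : GrMod.{v} 𝒜) (U : Submodule A M) (hU : ∀ i, ∀ x ∈ U, M.proj i x ∈ U) :
    GrMod.{v} 𝒜 where
  carrier := U
  deg i := (M.deg i).comap U.subtype.toAddMonoidHom
  isInternal := by
    refine isInternal_of_proj _
      (fun i => ((M.proj i).comp U.subtype.toAddMonoidHom).codRestrict U
        (fun x => hU i x x.2)) ?_ ?_ ?_
    · intro i x hx
      exact Subtype.ext (M.proj_of_mem hx)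
    · intro i j x hx h
      exact Subtype.ext (M.proj_of_mem_ne hx h)
    · intro x
      obtain ⟨s, hs⟩ := M.exists_sum_proj x
      refine ⟨s, fun i => ⟨M.proj i x, hU i x x.2⟩, fun i => M.proj_mem i x, Subtype.ext ?_⟩
      rw [AddSubmonoidClass.coe_finsetSum]
      exact hs
  smul_mem ha hx := M.smul_mem ha hx

/-- Kernels of graded modules, with the induced grading. -/
def ker (f : M ⟶ N) : GrMod.{v} 𝒜 :=
  M.ofSubmodule (LinearMap.ker f.lin) fun i x hx => by
    rw [LinearMap.mem_ker] at hx ⊢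
    rw [lin_proj, hx, map_zero]

/-- The inclusion of the kernel. -/
def kerι (f : M ⟶ N) : ker f ⟶ M := ⟨(LinearMap.ker f.lin).subtype, fun h => h⟩

/-- Factorization through the kernel. -/
def kerLift (f : M ⟶ N) (g : P ⟶ M) (h : g ≫ f = 0) : P ⟶ ker f :=
  ⟨g.lin.codRestrict _ fun x => by
    have := congrArg (fun k => Hom.lin k x) h
    exact this, fun hx => g.map_deg hx⟩

/-- Quotients by submodules closed under projections are graded. -/
theorem isInternal_quot (M : GrMod.{v} 𝒜) (U : Submodule A M)
    (hU : ∀ i, ∀ x ∈ U, M.proj i x ∈ U) :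
    DirectSum.IsInternal fun i => (M.deg i).map U.mkQ.toAddMonoidHom := by
  refine isInternal_of_proj _
    (fun i => QuotientAddGroup.map U.toAddSubgroup U.toAddSubgroup (M.proj i)
      (fun x hx => hU i x hx)) ?_ ?_ ?_
  · rintro i _ ⟨x, hx, rfl⟩
    exact congrArg U.mkQ (M.proj_of_mem hx)
  · rintro i j _ ⟨x, hx, rfl⟩ h
    exact (congrArg U.mkQ (M.proj_of_mem_ne hx h)).trans (map_zero _)
  · intro y
    obtain ⟨x, rfl⟩ := U.mkQ_surjective y
    obtain ⟨s, hs⟩ := M.exists_sum_proj x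
    refine ⟨s, fun i => U.mkQ (M.proj i x), fun i => ⟨_, M.proj_mem i x, rfl⟩, ?_⟩
    conv_lhs => rw [hs, map_sum]

/-- Cokernels of graded modules, with the induced grading. -/
def coker (f : M ⟶ N) : GrMod.{v} 𝒜 where
  carrier := N ⧸ LinearMap.range f.lin
  deg i := (N.deg i).map (LinearMap.range f.lin).mkQ.toAddMonoidHom
  isInternal := N.isInternal_quot _ (by
    rintro i _ ⟨x, rfl⟩
    exact ⟨M.proj i x, lin_proj f i x⟩)
  smul_mem := by
    rintro i j a _ ha ⟨x, hx, rfl⟩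
    exact ⟨a • x, N.smul_mem ha hx, rfl⟩

/-- The projection to the cokernel. -/
def cokerπ (f : M ⟶ N) : N ⟶ coker f :=
  ⟨(LinearMap.range f.lin).mkQ, fun {_ x} h => ⟨x, h, rfl⟩⟩

/-- Factorization through the cokernel. -/
def cokerDesc (f : M ⟶ N) (g : N ⟶ P) (h : f ≫ g = 0) : coker f ⟶ P :=
  ⟨(LinearMap.range f.lin).liftQ g.lin (by
    rintro _ ⟨x, rfl⟩
    exact congrArg (fun k => Hom.lin k x) h), by
    rintro i _ ⟨x, hx, rfl⟩
    exact g.map_deg hx⟩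

/-- The kernel has the universal property. -/
def kerIsLimit (f : M ⟶ N) :
    IsLimit (KernelFork.ofι (f := f) (kerι f) (hom_ext fun x => x.2)) :=
  KernelFork.IsLimit.ofι _ _ (fun g h => kerLift f g h) (fun _ _ => rfl)
    (fun _ _ _ hm => hom_ext fun x => Subtype.ext (congrArg (fun k => Hom.lin k x) hm))

/-- The cokernel has the universal property. -/
def cokerIsColimit (f : M ⟶ N) :
    IsColimit (CokernelCofork.ofπ (f := f) (cokerπ f) (hom_ext fun x =>
      (Submodule.Quotient.mk_eq_zero _).2 ⟨x, rfl⟩)) :=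
  CokernelCofork.IsColimit.ofπ _ _ (fun g h => cokerDesc f g h) (fun _ _ => rfl)
    (fun _ _ _ hm => hom_ext fun x => by
      obtain ⟨y, rfl⟩ := (LinearMap.range f.lin).mkQ_surjective x
      exact congrArg (fun k => Hom.lin k y) hm)

instance : HasKernels (GrMod.{v} 𝒜) := ⟨fun f => ⟨_, kerIsLimit f⟩⟩
instance : HasCokernels (GrMod.{v} 𝒜) := ⟨fun f => ⟨_, cokerIsColimit f⟩⟩

theorem injective_of_mono (f : M ⟶ N) [Mono f] : Function.Injective f.lin := by
  rw [← LinearMap.ker_eq_bot, eq_bot_iff]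
  intro x hx
  have h : kerι f = 0 := by
    rw [← cancel_mono f, zero_comp]
    exact hom_ext fun y => y.2
  exact congrArg (fun k => Hom.lin k (⟨x, hx⟩ : LinearMap.ker f.lin)) h

theorem surjective_of_epi (f : M ⟶ N) [Epi f] : Function.Surjective f.lin := by
  intro y
  have h : cokerπ f = 0 := by
    rw [← cancel_epi f, comp_zero]
    exact hom_ext fun x => (Submodule.Quotient.mk_eq_zero _).2 ⟨x, rfl⟩
  have hy : (LinearMap.range f.lin).mkQ y = 0 := congrArg (fun k => Hom.lin k y) h
  exact (Submodule.Quotient.mk_eq_zero _).1 hy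

theorem mem_deg_of_injective (f : M ⟶ N) (hf : Function.Injective f.lin) {i : Γ} {x : M}
    (h : f.lin x ∈ N.deg i) : x ∈ M.deg i := by
  have : M.proj i x = x := hf (by rw [lin_proj, N.proj_of_mem h])
  rw [← this]
  exact M.proj_mem i x

theorem exists_mem_deg_of_surjective (f : M ⟶ N) (hf : Function.Surjective f.lin) {i : Γ} {y : N}
    (h : y ∈ N.deg i) : ∃ x ∈ M.deg i, f.lin x = y := by
  obtain ⟨x, rfl⟩ := hf y
  exact ⟨M.proj i x, M.proj_mem i x, by rw [lin_proj, N.proj_of_mem h]⟩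

instance : IsNormalMonoCategory (GrMod.{v} 𝒜) where
  normalMonoOfMono {M N} f _ := ⟨by
    have hf := injective_of_mono f
    have hw : f ≫ cokerπ f = 0 := hom_ext fun x => (Submodule.Quotient.mk_eq_zero _).2 ⟨x, rfl⟩
    refine { Z := coker f, g := cokerπ f, w := hw, isLimit := ?_ }
    have hr : ∀ {P : GrMod.{v} 𝒜} (g : P ⟶ N), g ≫ cokerπ f = 0 →
        ∀ x, g.lin x ∈ LinearMap.range f.lin := fun g h x =>
      (Submodule.Quotient.mk_eq_zero _).1 (congrArg (fun k => Hom.lin k x) h)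
    have hs : ∀ {P : GrMod.{v} 𝒜} (g : P ⟶ N) (h : g ≫ cokerπ f = 0) (x : P),
        f.lin ((LinearEquiv.ofInjective f.lin hf).symm ⟨g.lin x, hr g h x⟩) = g.lin x := by
      intro P g h x
      exact congrArg Subtype.val
        ((LinearEquiv.ofInjective f.lin hf).apply_symm_apply ⟨g.lin x, hr g h x⟩)
    refine KernelFork.IsLimit.ofι _ _ (fun {P} g h =>
      ⟨(LinearEquiv.ofInjective f.lin hf).symm.toLinearMap.comp
        (g.lin.codRestrict _ (hr g h)), fun {i x} hx => ?_⟩) (fun {P} g h => ?_)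
      (fun {P} g h m hm => ?_)
    · refine mem_deg_of_injective f hf ?_
      change f.lin ((LinearEquiv.ofInjective f.lin hf).symm ⟨g.lin x, hr g h x⟩) ∈ _
      rw [hs g h x]
      exact g.map_deg hx
    · exact hom_ext fun x => hs g h x
    · refine hom_ext fun x => hf ?_
      exact (congrArg (fun k => Hom.lin k x) hm).trans (hs g h x).symm⟩

instance : IsNormalEpiCategory (GrMod.{v} 𝒜) where
  normalEpiOfEpi {M N} f _ := ⟨by
    have hf := surjective_of_epi f
    refine { W := ker f, g := kerι f, w := hom_ext fun x => x.2, isColimit := ?_ }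
    have hk : ∀ {P : GrMod.{v} 𝒜} (g : M ⟶ P), kerι f ≫ g = 0 →
        LinearMap.ker f.lin ≤ LinearMap.ker g.lin := fun g h x hx =>
      LinearMap.congr_fun (congrArg Hom.lin h) (⟨x, hx⟩ : LinearMap.ker f.lin)
    have hs : ∀ {P : GrMod.{v} 𝒜} (g : M ⟶ P) (h : kerι f ≫ g = 0) (x : M),
        (LinearMap.ker f.lin).liftQ g.lin (hk g h)
          ((f.lin.quotKerEquivOfSurjective hf).symm (f.lin x)) = g.lin x := by
      intro P g h x
      have : (f.lin.quotKerEquivOfSurjective hf).symm (f.lin x) =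
          (LinearMap.ker f.lin).mkQ x := by
        rw [LinearEquiv.symm_apply_eq]
        rfl
      rw [this]
      rfl
    refine CokernelCofork.IsColimit.ofπ _ _ (fun {P} g h =>
      ⟨((LinearMap.ker f.lin).liftQ g.lin (hk g h)).comp
        (f.lin.quotKerEquivOfSurjective hf).symm.toLinearMap, fun {i y} hy => ?_⟩)
      (fun {P} g h => ?_) (fun {P} g h m hm => ?_)
    · obtain ⟨x, hx, rfl⟩ := exists_mem_deg_of_surjective f hf hy
      change (LinearMap.ker f.lin).liftQ g.lin (hk g h)
          ((f.lin.quotKerEquivOfSurjective hf).symm (f.lin x)) ∈ _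
      rw [hs g h x]
      exact g.map_deg hx
    · exact hom_ext fun x => hs g h x
    · refine hom_ext fun y => ?_
      obtain ⟨x, rfl⟩ := hf y
      exact (congrArg (fun k => Hom.lin k x) hm).trans (hs g h x).symm⟩

/-- The zero graded module. -/
def zeroObj : GrMod.{v} 𝒜 where
  carrier := PUnit
  deg _ := ⊤
  isInternal := isInternal_of_proj _ (fun _ => 0) (fun _ _ _ => rfl) (fun _ _ _ _ _ => rfl)
    (fun _ => ⟨∅, fun _ => 0, fun _ => trivial, rfl⟩)
  smul_mem _ _ := trivial

instance : HasZeroObject (GrMod.{v} 𝒜) :=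
  ⟨zeroObj, (IsZero.iff_id_eq_zero _).2 (hom_ext fun _ => rfl)⟩

/-- The direct sum of two graded modules. -/
def prod (M N : GrMod.{v} 𝒜) : GrMod.{v} 𝒜 where
  carrier := M × N
  deg i := (M.deg i).prod (N.deg i)
  isInternal := by
    refine isInternal_of_proj _ (fun i => (M.proj i).prodMap (N.proj i)) ?_ ?_ ?_
    · rintro i ⟨x, y⟩ ⟨hx, hy⟩
      exact Prod.ext (M.proj_of_mem hx) (N.proj_of_mem hy)
    · rintro i j ⟨x, y⟩ ⟨hx, hy⟩ h
      exact Prod.ext (M.proj_of_mem_ne hx h) (N.proj_of_mem_ne hy h)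
    · rintro ⟨x, y⟩
      classical
      have hsum : ∀ (L : GrMod.{v} 𝒜) (z : L), ∃ s : Finset Γ, ∀ s', s ⊆ s' →
          z = ∑ i ∈ s', L.proj i z := by
        intro L z
        obtain ⟨s, hs⟩ := L.exists_sum_proj z
        refine ⟨s, fun s' hss => ?_⟩
        conv_lhs => rw [hs]
        refine Finset.sum_subset hss fun i _ hi => ?_
        rw [hs, map_sum]
        refine Finset.sum_eq_zero fun j hj => L.proj_of_mem_ne (L.proj_mem j z) ?_
        rintro rfl
        exact hi hj
      obtain ⟨s, hs⟩ := hsum M x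
      obtain ⟨s', hs'⟩ := hsum N y
      refine ⟨s ∪ s', fun i => (M.proj i x, N.proj i y),
        fun i => ⟨M.proj_mem i x, N.proj_mem i y⟩, Prod.ext ?_ ?_⟩
      · rw [Prod.fst_sum]
        exact hs _ Finset.subset_union_left
      · rw [Prod.snd_sum]
        exact hs' _ Finset.subset_union_right
  smul_mem ha hx := ⟨M.smul_mem ha hx.1, N.smul_mem ha hx.2⟩

instance : HasBinaryBiproducts (GrMod.{v} 𝒜) where
  has_binary_biproduct M N := by
    let b : BinaryBicone M N :=
      { pt := prod M N
        fst := ⟨LinearMap.fst A M N, fun h => h.1⟩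
        snd := ⟨LinearMap.snd A M N, fun h => h.2⟩
        inl := ⟨LinearMap.inl A M N, fun h => ⟨h, zero_mem _⟩⟩
        inr := ⟨LinearMap.inr A M N, fun h => ⟨zero_mem _, h⟩⟩
        inl_fst := rfl
        inl_snd := rfl
        inr_fst := rfl
        inr_snd := rfl }
    refine HasBinaryBiproduct.mk ⟨b, isBinaryBilimitOfTotal b (hom_ext fun x => ?_)⟩
    exact Prod.ext (add_zero _) (zero_add _)

instance : HasFiniteProducts (GrMod.{v} 𝒜) :=
  hasFiniteProducts_of_has_binary_and_terminal

instance : Abelian (GrMod.{v} 𝒜) where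

/-- The suspension `Σ^d M`, with `(Σ^d M)_i = M_{i-d}`. -/
def susp (d : Γ) (M : GrMod.{v} 𝒜) : GrMod.{v} 𝒜 where
  carrier := M
  deg i := M.deg (i - d)
  isInternal := by
    refine isInternal_of_proj _ (fun i => M.proj (i - d)) ?_ ?_ ?_
    · intro i x hx
      exact M.proj_of_mem hx
    · intro i j x hx h
      exact M.proj_of_mem_ne hx fun h' => h (sub_left_injective h')
    · intro x
      obtain ⟨s, hs⟩ := M.exists_sum_proj x
      refine ⟨s.map (Equiv.addRight d).toEmbedding, fun i => M.proj (i - d) x,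
        fun i => M.proj_mem _ x, ?_⟩
      rw [Finset.sum_map]
      simpa using hs
  smul_mem {i j a x} ha hx := by
    rw [add_sub_assoc]
    exact M.smul_mem ha hx

/-- Graded free modules: there is a basis consisting of homogeneous elements. -/
def IsFree (M : GrMod.{v} 𝒜) : Prop :=
  ∃ (ι : Type v) (b : Module.Basis ι A M), ∀ i, ∃ j, b i ∈ M.deg j

/-- Finite graded free modules: there is a finite basis consisting of homogeneous elements. -/
def IsFiniteFree (M : GrMod.{v} 𝒜) : Prop :=
  ∃ (n : ℕ) (b : Module.Basis (Fin n) A M), ∀ i, ∃ j, b i ∈ M.deg j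

end

/-! ### Graded modules over `R = S/(f)` -/

section

variable {Γ : Type t} [AddCommGroup Γ] [DecidableEq Γ] {S : Type u} [CommRing S]

/-- The grading of `R = S/(f)` induced from the one of `S`. -/
def quotGrading (𝒜 : Γ → AddSubgroup S) (f : S) : Γ → AddSubgroup (S ⧸ Ideal.span {f}) :=
  fun i => (𝒜 i).map (Ideal.Quotient.mk (Ideal.span {f})).toAddMonoidHom

variable {𝒜 : Γ → AddSubgroup S} {f : S}

/-- A graded `S/(f)`-module, regarded as a graded `S`-module. -/
def restrict (M : GrMod.{v} (quotGrading 𝒜 f)) : GrMod.{v} 𝒜 where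
  carrier := M
  module := Module.compHom M (Ideal.Quotient.mk (Ideal.span {f}))
  deg := M.deg
  isInternal := M.isInternal
  smul_mem ha hx := M.smul_mem (AddSubgroup.mem_map_of_mem _ ha) hx

theorem restrict_smul (M : GrMod.{v} (quotGrading 𝒜 f)) (a : S) (x : M) :
    (show M from (a • (show M.restrict from x))) = Ideal.Quotient.mk (Ideal.span {f}) a • x := rfl

theorem restrict_smul_eq_zero (M : GrMod.{v} (quotGrading 𝒜 f)) (x : M.restrict) :
    f • x = 0 := by
  change Ideal.Quotient.mk (Ideal.span {f}) f • (show M from x) = 0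
  rw [Ideal.Quotient.eq_zero_iff_mem.2 (Ideal.mem_span_singleton_self f), zero_smul]

theorem mem_span_smul_top {M : Type v} [AddCommGroup M] [Module S M] {x : M} :
    x ∈ (Ideal.span {f} • ⊤ : Submodule S M) ↔ ∃ y : M, f • y = x := by
  rw [Submodule.ideal_span_singleton_smul, Submodule.mem_smul_pointwise_iff_exists]
  simp

/-- The base change `R ⊗_S F = F/fF` of a graded `S`-module `F` to `R = S/(f)`. -/
def red {d : Γ} (hf : f ∈ 𝒜 d) (F : GrMod.{v} 𝒜) : GrMod.{v} (quotGrading 𝒜 f) where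
  carrier := F ⧸ (Ideal.span {f} • ⊤ : Submodule S F)
  deg i := (F.deg i).map (Ideal.span {f} • ⊤ : Submodule S F).mkQ.toAddMonoidHom
  isInternal := F.isInternal_quot _ (by
    intro i x hx
    obtain ⟨y, rfl⟩ := mem_span_smul_top.1 hx
    exact mem_span_smul_top.2 ⟨_, (F.proj_smul hf i y).symm⟩)
  smul_mem := by
    rintro i j _ _ ⟨a, ha, rfl⟩ ⟨x, hx, rfl⟩
    exact ⟨a • x, F.smul_mem ha hx, rfl⟩

/-- The base change of a morphism. -/
def redMap {d : Γ} (hf : f ∈ 𝒜 d) {F G : GrMod.{v} 𝒜} (φ : F ⟶ G) : red hf F ⟶ red hf G where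
  lin :=
    { toFun := Submodule.mapQ _ _ φ.lin (fun x hx => by
        obtain ⟨y, rfl⟩ := mem_span_smul_top.1 hx
        exact mem_span_smul_top.2 ⟨φ.lin y, (map_smul φ.lin f y).symm⟩)
      map_add' := fun x y => map_add _ x y
      map_smul' := fun a x => by
        obtain ⟨a, rfl⟩ := Ideal.Quotient.mk_surjective a
        exact (Submodule.mapQ _ _ φ.lin _).map_smul' a x }
  map_deg := by
    rintro i _ ⟨x, hx, rfl⟩
    exact ⟨φ.lin x, φ.map_deg hx, rfl⟩

variable {d : Γ} (hf : f ∈ 𝒜 d) {M : GrMod.{v} (quotGrading 𝒜 f)} {F : GrMod.{v} 𝒜}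
  (π : F ⟶ M.restrict)

/-- The map `F/fF ⟶ M` induced by `π : F ⟶ M`. -/
def redAug : red hf F ⟶ M where
  lin :=
    { toFun := Submodule.liftQ (Ideal.span {f} • ⊤ : Submodule S F) π.lin (fun x hx => by
        obtain ⟨y, rfl⟩ := mem_span_smul_top.1 hx
        rw [LinearMap.mem_ker, map_smul, restrict_smul_eq_zero])
      map_add' := fun x y => map_add _ x y
      map_smul' := fun a x => by
        obtain ⟨a, rfl⟩ := Ideal.Quotient.mk_surjective a
        exact (Submodule.liftQ (Ideal.span {f} • ⊤ : Submodule S F) π.lin _).map_smul' a x }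
  map_deg := by
    rintro i _ ⟨x, hx, rfl⟩
    exact π.map_deg hx

theorem kerι_redAug : redMap hf (kerι π) ≫ redAug hf π = 0 := by
  refine hom_ext fun x => ?_
  obtain ⟨y, rfl⟩ := (Ideal.span {f} • ⊤ : Submodule S (ker π)).mkQ_surjective x
  exact y.2

/-- Multiplication by `f` as a map from `F` to `K/fK`, where `K = ker π`. -/
def mulToRedKer : F →ₗ[S] (ker π ⧸ (Ideal.span {f} • ⊤ : Submodule S (ker π))) :=
  (Ideal.span {f} • ⊤ : Submodule S (ker π)).mkQ.comp
    ((LinearMap.lsmul S F f).codRestrict (LinearMap.ker π.lin) fun x => by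
      rw [LinearMap.mem_ker, LinearMap.lsmul_apply, map_smul, restrict_smul_eq_zero])

theorem ker_le_ker_mulToRedKer : LinearMap.ker π.lin ≤ LinearMap.ker (mulToRedKer π) :=
  fun x hx => (Submodule.Quotient.mk_eq_zero _).2 (mem_span_smul_top.2 ⟨⟨x, hx⟩, rfl⟩)

/-- The map `Σ^d M ⟶ K/fK`, sending `π x` to the class of `f x`; it is the canonical map
`Σ^d M ≅ Tor₁^S(R, M) ⟶ R ⊗_S K`. -/
def torMap (hπ : Function.Surjective π.lin) : M.susp d ⟶ red hf (ker π) where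
  lin :=
    { toFun := fun m => (LinearMap.ker π.lin).liftQ (mulToRedKer π) (ker_le_ker_mulToRedKer π)
        ((π.lin.quotKerEquivOfSurjective hπ).symm m)
      map_add' := fun x y => map_add (((LinearMap.ker π.lin).liftQ (mulToRedKer π)
        (ker_le_ker_mulToRedKer π)).comp
        (π.lin.quotKerEquivOfSurjective hπ).symm.toLinearMap) x y
      map_smul' := fun a x => by
        obtain ⟨a, rfl⟩ := Ideal.Quotient.mk_surjective a
        exact (((LinearMap.ker π.lin).liftQ (mulToRedKer π)
          (ker_le_ker_mulToRedKer π)).comp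
          (π.lin.quotKerEquivOfSurjective hπ).symm.toLinearMap).map_smul' a x }
  map_deg := by
    intro i m hm
    obtain ⟨x, hx, rfl⟩ := exists_mem_deg_of_surjective π hπ (y := m) hm
    have h : (π.lin.quotKerEquivOfSurjective hπ).symm (π.lin x) =
        (LinearMap.ker π.lin).mkQ x := by
      rw [LinearEquiv.symm_apply_eq]
      rfl
    have hfx : f • x ∈ F.deg i := by
      have := F.smul_mem hf hx
      rwa [add_sub_cancel] at this
    refine ⟨⟨f • x, ?_⟩, hfx, ?_⟩
    · rw [LinearMap.mem_ker, map_smul, restrict_smul_eq_zero]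
    · change _ = (LinearMap.ker π.lin).liftQ (mulToRedKer π) (ker_le_ker_mulToRedKer π)
        ((π.lin.quotKerEquivOfSurjective hπ).symm (π.lin x))
      rw [h]
      rfl

theorem torMap_apply (hπ : Function.Surjective π.lin) (x : F) :
    (torMap hf π hπ).lin (π.lin x) = mulToRedKer π x := by
  have h : (π.lin.quotKerEquivOfSurjective hπ).symm (π.lin x) =
      (LinearMap.ker π.lin).mkQ x := by
    rw [LinearEquiv.symm_apply_eq]
    rfl
  change (LinearMap.ker π.lin).liftQ (mulToRedKer π) (ker_le_ker_mulToRedKer π)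
    ((π.lin.quotKerEquivOfSurjective hπ).symm (π.lin x)) = _
  rw [h]
  rfl

/-- The first half `Σ^d M ⟶ K/fK ⟶ ker (F/fF ⟶ M)` of the sequence
`0 ⟶ Σ^d M ⟶ K/fK ⟶ F/fF ⟶ M ⟶ 0`. -/
def leftSeq (hπ : Function.Surjective π.lin) : ShortComplex (GrMod.{v} (quotGrading 𝒜 f)) :=
  ShortComplex.mk (torMap hf π hπ) (kerLift (redAug hf π) (redMap hf (kerι π)) (kerι_redAug hf π))
    (by
      refine hom_ext fun m => Subtype.ext ?_
      obtain ⟨x, rfl⟩ := hπ m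
      change (redMap hf (kerι π)).lin ((torMap hf π hπ).lin (π.lin x)) = 0
      rw [torMap_apply]
      exact (Submodule.Quotient.mk_eq_zero _).2 (mem_span_smul_top.2 ⟨x, rfl⟩))

/-- The second half `ker (F/fF ⟶ M) ⟶ F/fF ⟶ M` of the sequence
`0 ⟶ Σ^d M ⟶ K/fK ⟶ F/fF ⟶ M ⟶ 0`. -/
def rightSeq : ShortComplex (GrMod.{v} (quotGrading 𝒜 f)) :=
  ShortComplex.mk (kerι (redAug hf π)) (redAug hf π) (hom_ext fun x => x.2)

variable [HasDerivedCategory.{w} (GrMod.{v} (quotGrading 𝒜 f))]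

open DerivedCategory in
/-- The operator `χ_f : M ⟶ Σ^{d+2} M = (Σ^d M)[2]` in the derived category of graded
`S/(f)`-modules: the Yoneda class of `0 ⟶ Σ^d M ⟶ K/fK ⟶ F/fF ⟶ M ⟶ 0`, as the composite of
the connecting maps of its two halves. -/
def chi {hπ : Function.Surjective π.lin} (h₁ : (leftSeq hf π hπ).ShortExact)
    (h₂ : (rightSeq hf π).ShortExact) :
    (singleFunctor (GrMod.{v} (quotGrading 𝒜 f)) 0).obj M ⟶
      ((singleFunctor (GrMod.{v} (quotGrading 𝒜 f)) 0).obj (M.susp d))⟦(2 : ℤ)⟧ :=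
  ShiftedHom.comp (a := (1 : ℤ)) (b := (1 : ℤ)) (c := (2 : ℤ)) h₂.singleδ h₁.singleδ (by norm_num)

end

end GrMod

/-! ### Regular local graded rings, small and perfect objects -/

/-- Regular local rings, in the graded sense: a Noetherian graded ring with a unique maximal
homogeneous ideal, which is generated by a regular sequence of homogeneous elements.  For `Γ`
trivial this is a Noetherian local ring with maximal ideal generated by a regular sequence. -/
structure IsGradedRegularLocal {Γ : Type t} [AddCommGroup Γ] [DecidableEq Γ] {S : Type u}
    [CommRing S] (𝒜 : Γ → AddSubgroup S) [GradedRing 𝒜] : Prop where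
  isNoetherianRing : IsNoetherianRing S
  exists_maximal : ∃ m : Ideal S, m.IsHomogeneous 𝒜 ∧ m ≠ ⊤ ∧
    (∀ I : Ideal S, I.IsHomogeneous 𝒜 → I ≠ ⊤ → I ≤ m) ∧
    ∃ rs : List S, (∀ r ∈ rs, SetLike.IsHomogeneousElem 𝒜 r) ∧
      RingTheory.Sequence.IsRegular S rs ∧ Ideal.ofList rs = m

open Classical in
/-- Small objects: for every coproduct `∐ N i` the natural map
`⨁ Hom(X, N i) ⟶ Hom(X, ∐ N i)` is bijective. -/
def IsSmallObject {T : Type*} [Category* T] [Preadditive T] (X : T) : Prop :=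
  ∀ (ι : Type t) (N : ι → T) (c : Cofan N), Nonempty (IsColimit c) →
    Function.Bijective (DirectSum.toAddMonoid (β := fun i => X ⟶ N i)
      (fun i => Preadditive.rightComp X (c.inj i)))

/-- Perfect objects: those isomorphic in the derived category to a bounded complex of finite
graded free modules. -/
def IsPerfectObject {Γ : Type t} [AddCommGroup Γ] [DecidableEq Γ] {A : Type u} [CommRing A]
    {𝒜 : Γ → AddSubgroup A} [HasDerivedCategory.{w} (GrMod.{v} 𝒜)]
    (X : DerivedCategory (GrMod.{v} 𝒜)) : Prop :=
  ∃ P : CochainComplex (GrMod.{v} 𝒜) ℤ,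
    (∃ a b : ℤ, ∀ i, i < a ∨ b < i → IsZero (P.X i)) ∧ (∀ i, (P.X i).IsFiniteFree) ∧
      Nonempty (X ≅ DerivedCategory.Q.obj P)

end

/-! Write `K = ker π` and `Z = ker (F/fF ⟶ M)`. By construction `χ_f` is the composite of the
connecting maps `M ⟶ Z[1]` and `Z[1] ⟶ Σ^d M[2]`, whose cones are `(F/fF)[1]` and `(K/fK)[2]`. By
the octahedral axiom (`HasPerfectCone.comp`) the cone of `χ_f` is an extension of these two, so it
is perfect as soon as `F/fF` and `K/fK` are.

This requires a finite `F`. A cover by a finite graded free module maps to any `F` over `M`, and the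
induced morphism of four-term sequences is the identity on both ends, so both covers define the same
`χ_f` (`chi_eq`). For finite `F`, the module `F/fF` is finite free over `R`, and `K` is a finitely
generated submodule of `F`, so `f` is regular on it. The graded syzygy theorem
(`induction_on_syzygies`) gives `K` a finite resolution by finite graded free `S`-modules, and
regularity of `f` keeps it exact modulo `f` (`shortExact_red`, `isPerfectObject_red`).

Two facts on `S` enter. Syzygies gain one step of regularity each time along the sequence generating
the maximal homogeneous ideal, and a finitely generated module regular along the whole sequence is
free by graded Nakayama. Moreover `S` is a domain as far as homogeneous elements are concerned, so
the nonzero homogeneous `f` is a nonzerodivisor.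

Smallness follows from perfection (`IsPerfectObject.isSmallObject`): maps out of a bounded complex
of finite free modules are represented by chain maps, and a chain map from it to a direct sum of
complexes meets only finitely many summands. -/

noncomputable section

namespace GrMod

/-! ### Homogeneous bases and projectivity of graded free modules -/

section Free

variable {Γ : Type t} [AddCommGroup Γ] [DecidableEq Γ] {A : Type u} [CommRing A]
  {𝒜 : Γ → AddSubgroup A}

/-- A linear map which preserves the degrees of the elements of a homogeneous basis preserves
degrees. -/
theorem map_deg_of_basis (hA : ⨆ i, 𝒜 i = ⊤) {M N : GrMod.{v} 𝒜} {ι : Type*}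
    (b : Module.Basis ι A M) (φ : M →ₗ[A] N) {e : ι → Γ} (hb : ∀ j, b j ∈ M.deg (e j))
    (hφ : ∀ j, φ (b j) ∈ N.deg (e j)) {i : Γ} {x : M} (hx : x ∈ M.deg i) : φ x ∈ N.deg i := by
  -- Commuting with all projections is a condition on arbitrary elements, so it can be checked along
  -- linear combinations of basis elements.
  have key : ∀ x : M, ∀ i, N.proj i (φ x) = φ (M.proj i x) := by
    intro x
    induction b.mem_span x using Submodule.span_induction with
    | mem x hx =>
      obtain ⟨j, rfl⟩ := hx
      intro i
      by_cases h : e j = i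
      · subst h
        rw [M.proj_of_mem (hb j), N.proj_of_mem (hφ j)]
      · rw [M.proj_of_mem_ne (hb j) h, N.proj_of_mem_ne (hφ j) h, map_zero]
    | zero => simp
    | add x y _ _ hx hy => simp [hx, hy]
    | smul a x _ hx =>
      have ha : a ∈ ⨆ i, 𝒜 i := hA ▸ AddSubgroup.mem_top a
      induction ha using AddSubgroup.iSup_induction' with
      | hp k a ha => intro i; rw [map_smul, N.proj_smul ha, M.proj_smul ha, map_smul, hx]
      | h1 => simp
      | hadd a a' _ _ h h' => intro i; rw [add_smul, map_add, map_add, map_add, map_add, h, h']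
  rw [← M.proj_of_mem hx, ← key]
  exact N.proj_mem i _

/-- The morphism given by prescribing the images of the elements of a homogeneous basis. -/
def ofBasis (hA : ⨆ i, 𝒜 i = ⊤) {M N : GrMod.{v} 𝒜} {ι : Type*}
    (b : Module.Basis ι A M) {e : ι → Γ} (hb : ∀ j, b j ∈ M.deg (e j)) (y : ι → N)
    (hy : ∀ j, y j ∈ N.deg (e j)) : M ⟶ N :=
  ⟨b.constr ℕ y, map_deg_of_basis hA b _ hb fun j => by rw [b.constr_basis]; exact hy j⟩

theorem ofBasis_apply (hA : ⨆ i, 𝒜 i = ⊤) {M N : GrMod.{v} 𝒜} {ι : Type*}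
    (b : Module.Basis ι A M) {e : ι → Γ} (hb : ∀ j, b j ∈ M.deg (e j)) (y : ι → N)
    (hy : ∀ j, y j ∈ N.deg (e j)) (j : ι) : (ofBasis hA b hb y hy).lin (b j) = y j :=
  b.constr_basis ℕ y j

theorem epi_of_surjective {M N : GrMod.{v} 𝒜} (f : M ⟶ N) (hf : Function.Surjective f.lin) :
    Epi f :=
  ⟨fun _ _ H => hom_ext fun x => by
    obtain ⟨y, rfl⟩ := hf x
    exact congrArg (fun k => Hom.lin k y) H⟩

theorem mono_of_injective {M N : GrMod.{v} 𝒜} (f : M ⟶ N) (hf : Function.Injective f.lin) :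
    Mono f :=
  ⟨fun _ _ H => hom_ext fun x => hf (congrArg (fun k => Hom.lin k x) H)⟩

/-- Graded free modules are projective. -/
theorem IsFree.projective (hA : ⨆ i, 𝒜 i = ⊤) {M : GrMod.{v} 𝒜} (hM : M.IsFree) :
    Projective M := by
  obtain ⟨ι, b, hb⟩ := hM
  choose e he using hb
  refine ⟨fun {E X} f g _ => ?_⟩
  choose y hy hgy using fun j => exists_mem_deg_of_surjective g (surjective_of_epi g)
    (f.map_deg (he j))
  refine ⟨ofBasis hA b he y hy, Hom.ext (b.ext fun j => ?_)⟩
  rw [comp_lin, LinearMap.comp_apply, ofBasis_apply, hgy]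

theorem IsFiniteFree.isFree {M : GrMod.{v} 𝒜} (hM : M.IsFiniteFree) : M.IsFree := by
  obtain ⟨n, b, hb⟩ := hM
  exact ⟨ULift (Fin n), b.reindex Equiv.ulift.symm, fun i => by simpa using hb i.down⟩

theorem IsFiniteFree.finite {M : GrMod.{v} 𝒜} (hM : M.IsFiniteFree) : Module.Finite A M := by
  obtain ⟨n, b, -⟩ := hM
  exact Module.Finite.of_basis b

theorem isFiniteFree_of_bijective {F N : GrMod.{v} 𝒜} (hF : F.IsFiniteFree) (p : F ⟶ N)
    (hp : Function.Bijective p.lin) : N.IsFiniteFree := by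
  obtain ⟨n, b, hb⟩ := hF
  refine ⟨n, b.map (LinearEquiv.ofBijective p.lin hp), fun i => ?_⟩
  obtain ⟨j, hj⟩ := hb i
  exact ⟨j, by rw [Module.Basis.map_apply]; exact p.map_deg hj⟩

theorem IsFiniteFree.of_iso {M N : GrMod.{v} 𝒜} (e : M ≅ N) (hM : M.IsFiniteFree) :
    N.IsFiniteFree :=
  isFiniteFree_of_bijective hM e.hom ⟨injective_of_mono _, surjective_of_epi _⟩

theorem IsFiniteFree.prod {M N : GrMod.{v} 𝒜} (hM : M.IsFiniteFree) (hN : N.IsFiniteFree) :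
    (GrMod.prod M N).IsFiniteFree := by
  obtain ⟨m, p, hp⟩ := hM
  obtain ⟨n, q, hq⟩ := hN
  have key : ∀ i : Fin m ⊕ Fin n, ∃ j, p.prod q i ∈ (M.deg j).prod (N.deg j) := by
    rintro (i | i)
    · obtain ⟨j, hj⟩ := hp i
      exact ⟨j, by rw [Module.Basis.prod_apply]; exact ⟨hj, zero_mem _⟩⟩
    · obtain ⟨j, hj⟩ := hq i
      exact ⟨j, by rw [Module.Basis.prod_apply]; exact ⟨zero_mem _, hj⟩⟩
  refine ⟨m + n, (p.prod q).reindex finSumFinEquiv, fun i => ?_⟩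
  obtain ⟨j, hj⟩ := key (finSumFinEquiv.symm i)
  exact ⟨j, (congrArg (· ∈ (M.deg j).prod (N.deg j))
    (Module.Basis.reindex_apply (p.prod q) finSumFinEquiv i)).mpr hj⟩

theorem IsFiniteFree.biprod {M N : GrMod.{v} 𝒜} (hM : M.IsFiniteFree) (hN : N.IsFiniteFree) :
    (M ⊞ N).IsFiniteFree := by
  let b : BinaryBicone M N :=
    { pt := GrMod.prod M N
      fst := ⟨LinearMap.fst A M N, fun h => h.1⟩
      snd := ⟨LinearMap.snd A M N, fun h => h.2⟩
      inl := ⟨LinearMap.inl A M N, fun h => ⟨h, zero_mem _⟩⟩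
      inr := ⟨LinearMap.inr A M N, fun h => ⟨zero_mem _, h⟩⟩
      inl_fst := rfl
      inl_snd := rfl
      inr_fst := rfl
      inr_snd := rfl }
  have hb : b.IsBilimit := isBinaryBilimitOfTotal b (hom_ext fun x => by
    exact Prod.ext (add_zero _) (zero_add _))
  exact IsFiniteFree.of_iso (biprod.uniqueUpToIso M N hb) (hM.prod hN)

theorem isFiniteFree_of_isZero {M : GrMod.{v} 𝒜} (hM : IsZero M) : M.IsFiniteFree := by
  have : Subsingleton M := ⟨fun x y => by
    have h := fun z => congrArg (fun k => Hom.lin k z) (hM.eq_of_src (𝟙 M) 0)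
    exact (h x).trans (h y).symm⟩
  exact ⟨0, Module.Basis.empty _, fun i => i.elim0⟩

end Free

/-! ### Finite graded free modules with prescribed degrees -/

section FreeMod

variable {Γ : Type t} [AddCommGroup Γ] [DecidableEq Γ] {S : Type u} [CommRing S]
  (𝒜 : Γ → AddSubgroup S) [GradedRing 𝒜]

theorem iSup_grading : ⨆ i, 𝒜 i = ⊤ := by
  classical
  rw [eq_top_iff]
  intro x _
  rw [← DirectSum.sum_support_decompose 𝒜 x]
  exact sum_mem fun i _ => AddSubgroup.mem_iSup_of_mem i (SetLike.coe_mem _)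

theorem iSup_quotGrading (f : S) : ⨆ i, quotGrading 𝒜 f i = ⊤ := by
  change ⨆ i, (𝒜 i).map _ = ⊤
  rw [← AddSubgroup.map_iSup, iSup_grading, ← AddMonoidHom.range_eq_map]
  exact AddMonoidHom.range_eq_top.2 Ideal.Quotient.mk_surjective

/-- The graded free module with basis elements of degrees `e 0, …, e (n - 1)`. -/
def free {n : ℕ} (e : Fin n → Γ) : GrMod.{u} 𝒜 where
  carrier := Fin n → S
  deg i := AddSubgroup.pi Set.univ fun j => 𝒜 (i - e j)
  isInternal := by
    refine isInternal_of_proj _ (fun i => AddMonoidHom.pi fun j =>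
      (GradedRing.proj 𝒜 (i - e j)).comp (Pi.evalAddMonoidHom _ j)) ?_ ?_ ?_
    · intro i x hx
      funext j
      exact DirectSum.decompose_of_mem_same 𝒜 (hx j trivial)
    · intro i k x hx h
      funext j
      exact DirectSum.decompose_of_mem_ne 𝒜 (hx j trivial) fun h' => h (sub_left_injective h')
    · classical
      intro x
      refine ⟨Finset.univ.biUnion fun j => (DirectSum.decompose 𝒜 (x j)).support.map
          (Equiv.addRight (e j)).toEmbedding,
        fun i j => DirectSum.decompose 𝒜 (x j) (i - e j),
        fun i j _ => (DirectSum.decompose 𝒜 (x j) (i - e j)).2, ?_⟩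
      funext j
      rw [Finset.sum_apply]
      conv_lhs => rw [← DirectSum.sum_support_decompose 𝒜 (x j)]
      symm
      rw [← Finset.sum_subset (Finset.subset_biUnion_of_mem _ (Finset.mem_univ j))]
      · rw [Finset.sum_map]
        refine Finset.sum_congr rfl fun k _ => ?_
        change (DirectSum.decompose 𝒜 (x j) (k + e j - e j) : S) = _
        rw [add_sub_cancel_right]
      · intro i _ hi
        by_contra h
        refine hi (Finset.mem_map.2 ⟨i - e j, ?_, by simp⟩)
        rw [DFinsupp.mem_support_iff]
        intro h'
        rw [h'] at h
        exact h rfl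
  smul_mem {i k a x} ha hx j _ := by
    have h := SetLike.GradedMul.mul_mem ha (hx j trivial)
    rwa [← add_sub_assoc] at h

/-- The standard basis of the graded free module. -/
def freeBasis {n : ℕ} (e : Fin n → Γ) : Module.Basis (Fin n) S (free 𝒜 e) :=
  Pi.basisFun S (Fin n)

theorem freeBasis_mem {n : ℕ} (e : Fin n → Γ) (j : Fin n) :
    freeBasis 𝒜 e j ∈ (free 𝒜 e).deg (e j) := by
  have h : freeBasis 𝒜 e j = (Pi.single j 1 : Fin n → S) := Pi.basisFun_apply S (Fin n) j
  rw [h]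
  intro k _
  by_cases hk : k = j
  · subst hk
    simpa using SetLike.GradedOne.one_mem (A := 𝒜)
  · simp [hk]

theorem free_isFiniteFree {n : ℕ} (e : Fin n → Γ) : (free 𝒜 e).IsFiniteFree :=
  ⟨n, freeBasis 𝒜 e, fun j => ⟨_, freeBasis_mem 𝒜 e j⟩⟩

end FreeMod

/-- A finitely generated graded module is generated by finitely many homogeneous elements. -/
theorem exists_homogeneous_generators {Γ : Type t} [AddCommGroup Γ] [DecidableEq Γ] {A : Type u}
    [CommRing A] {𝒜 : Γ → AddSubgroup A} (N : GrMod.{v} 𝒜) [Module.Finite A N] :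
    ∃ (n : ℕ) (v : Fin n → N), (∀ j, ∃ i, v j ∈ N.deg i) ∧
      Submodule.span A (Set.range v) = ⊤ := by
  classical
  obtain ⟨s, hs⟩ := Module.Finite.fg_top (R := A) (M := N)
  choose t ht using N.exists_sum_proj
  let T : Finset N := s.biUnion fun x => (t x).image fun i => N.proj i x
  refine ⟨T.card, fun j => T.equivFin.symm j, fun j => ?_, ?_⟩
  · obtain ⟨x, -, hx⟩ := Finset.mem_biUnion.1 (T.equivFin.symm j).2
    obtain ⟨i, -, hi⟩ := Finset.mem_image.1 hx
    exact ⟨i, hi.subst (motive := fun y => y ∈ N.deg i) (N.proj_mem i x)⟩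
  · have hr : Set.range (fun j => (T.equivFin.symm j : N)) = T := by
      ext y
      exact ⟨by rintro ⟨j, rfl⟩; exact (T.equivFin.symm j).2,
        fun hy => ⟨T.equivFin ⟨y, hy⟩, by simp⟩⟩
    rw [hr, eq_top_iff, ← hs, Submodule.span_le]
    intro x hx
    rw [SetLike.mem_coe, ht x]
    refine Submodule.sum_mem _ fun i hi => Submodule.subset_span ?_
    exact Finset.mem_biUnion.2 ⟨x, hx, Finset.mem_image.2 ⟨i, hi, rfl⟩⟩

end GrMod

/-! ### Graded local algebra: Nakayama and minimal covers -/

/-- The homogeneous ideal `m` is proper and contains all proper homogeneous ideals. -/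
structure IsGradedMaximal {Γ : Type t} [AddCommGroup Γ] [DecidableEq Γ] {S : Type u} [CommRing S]
    (𝒜 : Γ → AddSubgroup S) [GradedRing 𝒜] (m : Ideal S) : Prop where
  isHomogeneous : m.IsHomogeneous 𝒜
  ne_top : m ≠ ⊤
  le : ∀ I : Ideal S, I.IsHomogeneous 𝒜 → I ≠ ⊤ → I ≤ m

namespace GrMod

section Local

variable {Γ : Type t} [AddCommGroup Γ] [DecidableEq Γ] {S : Type u} [CommRing S]
  {𝒜 : Γ → AddSubgroup S} [GradedRing 𝒜] {m : Ideal S}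

/-- Only the component of `a` of degree `i - j` moves degree `j` to degree `i`. This extracts
homogeneous relations from relations with arbitrary coefficients. -/
theorem proj_smul_of_mem (N : GrMod.{v} 𝒜) (a : S) {j : Γ} {x : N} (hx : x ∈ N.deg j) (i : Γ) :
    N.proj i (a • x) = (DirectSum.decompose 𝒜 a (i - j) : S) • x := by
  induction a using DirectSum.Decomposition.inductionOn 𝒜 with
  | zero => simp
  | @homogeneous k a =>
    rw [N.proj_smul a.2]
    by_cases h : j = i - k
    · rw [N.proj_of_mem (h ▸ hx), DirectSum.decompose_coe, h, sub_sub_cancel,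
        DirectSum.of_eq_same]
    · rw [N.proj_of_mem_ne hx h, DirectSum.decompose_coe, DirectSum.of_eq_of_ne, smul_zero]
      · simp
      · rintro rfl
        exact h (by abel)
  | add a a' h h' => rw [add_smul, map_add, h, h', ← add_smul, DirectSum.decompose_add]; rfl

/-- The principal ideal of a homogeneous element is homogeneous, so if it were proper it would lie
in `m`. -/
theorem _root_.IsGradedMaximal.isUnit (hm : IsGradedMaximal 𝒜 m) {a : S} {i : Γ} (ha : a ∈ 𝒜 i)
    (ha' : a ∉ m) : IsUnit a := by
  by_contra h
  refine ha' (hm.le _ (Ideal.homogeneous_span 𝒜 _ ?_) (fun h' => h ?_)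
    (Ideal.mem_span_singleton_self a))
  · rintro x rfl
    exact ⟨i, ha⟩
  · exact Ideal.span_singleton_eq_top.1 h'

/-- Graded Nakayama lemma. -/
theorem subsingleton_of_top_le_smul (hm : IsGradedMaximal 𝒜 m) (N : GrMod.{v} 𝒜)
    [Module.Finite S N] (h : (⊤ : Submodule S N) ≤ m • ⊤) : Subsingleton N := by
  obtain ⟨r, hr, hrN⟩ := Submodule.exists_sub_one_mem_and_smul_eq_zero_of_fg_of_le_smul m
    (⊤ : Submodule S N) Module.Finite.fg_top h
  -- The annihilator `r ≡ 1` mod `m` of ordinary Nakayama need not be homogeneous, but its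
  -- degree-zero part is again `1` modulo `m`, hence a unit, and it still kills every homogeneous
  -- element.
  have h0 : (DirectSum.decompose 𝒜 r 0 : S) ∉ m := by
    intro h0
    have h1 := hm.isHomogeneous 0 hr
    rw [DirectSum.decompose_sub, DirectSum.sub_apply, AddSubgroup.coe_sub,
      DirectSum.decompose_of_mem_same 𝒜 (SetLike.GradedOne.one_mem (A := 𝒜))] at h1
    refine hm.ne_top ((Ideal.eq_top_iff_one m).2 ?_)
    simpa using sub_mem h0 h1
  obtain ⟨c, hc⟩ := hm.isUnit (SetLike.coe_mem _) h0
  have key : DistribSMul.toAddMonoidHom N (DirectSum.decompose 𝒜 r 0 : S) = 0 := by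
    refine N.addHom_ext fun i x hx => ?_
    have := N.proj_smul_of_mem r hx i
    rw [hrN x trivial, map_zero, sub_self] at this
    exact this.symm
  refine subsingleton_of_forall_eq 0 fun x => ?_
  have hx := DFunLike.congr_fun key x
  change (DirectSum.decompose 𝒜 r 0 : S) • x = 0 at hx
  rw [← hc] at hx
  simpa using congrArg (fun z => (↑c⁻¹ : S) • z) hx

variable (𝒜) in
/-- The morphism from a graded free module given by homogeneous elements. -/
def freeHom {N : GrMod.{u} 𝒜} {n : ℕ} {e : Fin n → Γ} (v : Fin n → N)
    (hv : ∀ j, v j ∈ N.deg (e j)) : free 𝒜 e ⟶ N :=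
  ofBasis (iSup_grading 𝒜) (freeBasis 𝒜 e) (freeBasis_mem 𝒜 e) v hv

theorem freeHom_apply {N : GrMod.{u} 𝒜} {n : ℕ} {e : Fin n → Γ} (v : Fin n → N)
    (hv : ∀ j, v j ∈ N.deg (e j)) (x : Fin n → S) :
    (freeHom 𝒜 v hv).lin x = ∑ j, x j • v j :=
  (freeBasis 𝒜 e).constr_apply_fintype ℕ v x

theorem freeHom_surjective {N : GrMod.{u} 𝒜} {n : ℕ} {e : Fin n → Γ} (v : Fin n → N)
    (hv : ∀ j, v j ∈ N.deg (e j)) (h : Submodule.span S (Set.range v) = ⊤) :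
    Function.Surjective (freeHom 𝒜 v hv).lin := by
  rw [← LinearMap.range_eq_top, ← h]
  exact (freeBasis 𝒜 e).constr_range ℕ

/-- A finitely generated graded module is the image of a finite graded free module by a morphism
whose kernel is contained in `m` times the free module. -/
theorem exists_minimal_cover (hm : IsGradedMaximal 𝒜 m) (N : GrMod.{u} 𝒜) [Module.Finite S N] :
    ∃ (n : ℕ) (e : Fin n → Γ) (p : free 𝒜 e ⟶ N), Function.Surjective p.lin ∧
      LinearMap.ker p.lin ≤ m • ⊤ := by
  classical
  -- Minimality of the cover means a least number of homogeneous generators.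
  have hex := N.exists_homogeneous_generators
  obtain ⟨v, hv, hspan⟩ := Nat.find_spec hex
  have hmin := fun k => Nat.find_min hex (m := k)
  generalize Nat.find hex = n at v hv hspan hmin
  choose e he using hv
  refine ⟨n, e, freeHom 𝒜 v he, freeHom_surjective v he hspan, ?_⟩
  intro (x : Fin n → S) hx
  have hsum : ∑ j, x j • v j = 0 := (freeHom_apply v he x).symm.trans hx
  suffices h : ∀ j, x j ∈ m by
    rw [← (freeBasis 𝒜 e).sum_repr x]
    exact Submodule.sum_mem _ fun j _ => Submodule.smul_mem_smul (h j) trivial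
  intro j
  by_contra hj
  obtain ⟨k, hk⟩ : ∃ k, (DirectSum.decompose 𝒜 (x j) k : S) ∉ m := by
    by_contra! h
    refine hj ?_
    rw [← DirectSum.sum_support_decompose 𝒜 (x j)]
    exact sum_mem fun i _ => h i
  obtain ⟨c, hc⟩ := hm.isUnit (SetLike.coe_mem _) hk
  -- In degree `k + e j` the coefficient of `v j` is the degree-`k` part of `x j`, a unit. So `v j`
  -- is redundant, contradicting minimality.
  have hrel := congrArg (N.proj (k + e j)) hsum
  rw [map_sum, map_zero] at hrel
  simp_rw [fun l => N.proj_smul_of_mem (x l) (he l) (k + e j)] at hrel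
  cases n with
  | zero => exact j.elim0
  | succ n =>
    refine hmin n n.lt_succ_self ⟨fun l => v (j.succAbove l), fun l => ⟨_, he _⟩, ?_⟩
    rw [eq_top_iff, ← hspan, Submodule.span_le]
    rintro _ ⟨l, rfl⟩
    by_cases hl : l = j
    · subst hl
      rw [Fin.sum_univ_succAbove _ l, add_sub_cancel_right, ← hc] at hrel
      have h2 := eq_neg_of_add_eq_zero_left hrel
      have h3 : v l = (↑c⁻¹ : S) • ((c : S) • v l) := by
        rw [smul_smul, Units.inv_mul, one_smul]
      rw [h3, h2]
      refine Submodule.smul_mem _ _ (neg_mem (Submodule.sum_mem _ fun i _ => ?_))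
      exact Submodule.smul_mem _ _ (Submodule.subset_span ⟨i, rfl⟩)
    · obtain ⟨i, rfl⟩ := Fin.exists_succAbove_eq hl
      exact Submodule.subset_span ⟨i, rfl⟩

end Local

end GrMod

/-! ### Regular sequences along a surjection and its kernel -/

/-- The first `k` elements of `rs` form a weakly regular sequence on `N`. -/
def IsRegularUpTo {R : Type*} [CommRing R] (N : Type*) [AddCommGroup N] [Module R N] (rs : List R)
    (k : ℕ) : Prop :=
  ∀ (i : ℕ) (h : i < rs.length), i < k → ∀ y : N,
    rs[i] • y ∈ (Ideal.ofList (rs.take i) • ⊤ : Submodule R N) →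
      y ∈ (Ideal.ofList (rs.take i) • ⊤ : Submodule R N)

namespace IsRegularUpTo

variable {R : Type*} [CommRing R] {G N : Type*} [AddCommGroup G] [Module R G] [AddCommGroup N]
  [Module R N] {rs : List R} {k : ℕ}

theorem mono {l : ℕ} (h : IsRegularUpTo N rs k) (hl : l ≤ k) : IsRegularUpTo N rs l :=
  fun i hi hil => h i hi (hil.trans_le hl)

theorem of_isWeaklyRegular (h : RingTheory.Sequence.IsWeaklyRegular N rs) (k : ℕ) :
    IsRegularUpTo N rs k :=
  fun i hi _ => (isSMulRegular_quotient_iff_mem_of_smul_mem _ _).1 (h.regular_mod_prev i hi)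

/-- A free module is flat, so tensoring with it preserves weak regularity, and `G ⊗ R ≅ G`. -/
theorem of_free [Module.Free R G] (h : RingTheory.Sequence.IsWeaklyRegular R rs) (k : ℕ) :
    IsRegularUpTo G rs k :=
  of_isWeaklyRegular (((TensorProduct.rid R G).isWeaklyRegular_congr rs).1
    h.isWeaklyRegular_lTensor) k

/-- If `I` is generated by a sequence which is regular on the target of a surjection `p : G ⟶ N`
with kernel `K`, then `K ∩ I G = I K`. -/
theorem mem_smul_ker (p : G →ₗ[R] N) (hp : Function.Surjective p) (h : IsRegularUpTo N rs k)
    (x : G) (hx : p x = 0) (hx' : x ∈ (Ideal.ofList (rs.take k) • ⊤ : Submodule R G)) :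
    x ∈ Ideal.ofList (rs.take k) • LinearMap.ker p := by
  induction k generalizing x with
  | zero => simpa using hx'
  | succ k ih =>
    by_cases hk : k < rs.length
    · have htake : Ideal.ofList (rs.take (k + 1)) =
          Ideal.ofList (rs.take k) ⊔ Ideal.span {rs[k]} := by
        rw [List.take_succ_eq_append_getElem hk, Ideal.ofList_append, Ideal.ofList_singleton]
      rw [htake, Submodule.sup_smul] at hx' ⊢
      obtain ⟨z, hz, w, hw, rfl⟩ := Submodule.mem_sup.1 hx'
      obtain ⟨y, rfl⟩ := GrMod.mem_span_smul_top.1 hw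
      have hmap : Submodule.map p (Ideal.ofList (rs.take k) • ⊤) = Ideal.ofList (rs.take k) • ⊤ := by
        rw [Submodule.map_smul'', Submodule.map_top, LinearMap.range_eq_top.2 hp]
      -- From `p (z + r y) = 0` one gets `r • p y ∈ I_k N`, hence `p y ∈ I_k N` by regularity. A
      -- lift `z'` of `p y` to `I_k G` then splits the element as `(z + r z') + r (y - z')`: the
      -- first summand is in the scope of the induction, the second lies in `r K`.
      have hy : p y ∈ (Ideal.ofList (rs.take k) • ⊤ : Submodule R N) := by
        refine h k hk k.lt_succ_self (p y) ?_
        rw [map_add, map_smul] at hx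
        rw [eq_neg_of_add_eq_zero_right hx, ← hmap]
        exact neg_mem (Submodule.mem_map_of_mem hz)
      rw [← hmap] at hy
      obtain ⟨z', hz', hzy⟩ := hy
      have hk' : y - z' ∈ LinearMap.ker p := by rw [LinearMap.mem_ker, map_sub, hzy, sub_self]
      have hxz : z + rs[k] • y = (z + rs[k] • z') + rs[k] • (y - z') := by
        rw [smul_sub]
        abel
      rw [hxz] at hx ⊢
      refine Submodule.add_mem_sup (ih (h.mono k.le_succ) _ ?_
        (add_mem hz (Submodule.smul_mem _ _ hz'))) ?_
      · rwa [map_add p (z + _), map_smul p _ (y - z'), LinearMap.mem_ker.1 hk', smul_zero,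
          add_zero] at hx
      · exact Submodule.smul_mem_smul (Ideal.mem_span_singleton_self _) hk'
    -- Past the end of the list, `take` no longer changes.
    · rw [List.take_of_length_le (by omega : rs.length ≤ k + 1)] at hx' ⊢
      rw [List.take_of_length_le (by omega : rs.length ≤ k)] at ih
      exact ih (h.mono k.le_succ) x hx hx'

/-- This is `mem_smul_ker` read inside the kernel as a module of its own, the form that Nakayama and
the regularity of the kernel need. -/
theorem mem_smul_top_ker (p : G →ₗ[R] N) (hp : Function.Surjective p) (h : IsRegularUpTo N rs k)
    (x : LinearMap.ker p) (hx : (x : G) ∈ (Ideal.ofList (rs.take k) • ⊤ : Submodule R G)) :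
    x ∈ (Ideal.ofList (rs.take k) • ⊤ : Submodule R (LinearMap.ker p)) := by
  have := h.mem_smul_ker p hp x x.2 hx
  have hmap : Submodule.map (LinearMap.ker p).subtype (Ideal.ofList (rs.take k) • ⊤) =
      Ideal.ofList (rs.take k) • LinearMap.ker p := by
    rw [Submodule.map_smul'', Submodule.map_top, Submodule.range_subtype]
  rw [← hmap] at this
  obtain ⟨y, hy, hyx⟩ := this
  rwa [Subtype.ext hyx] at hy

/-- The kernel of a surjection is regular in one step more than its target. -/
theorem ker (p : G →ₗ[R] N) (hp : Function.Surjective p) (h : IsRegularUpTo N rs k)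
    (hG : IsRegularUpTo G rs (k + 1)) : IsRegularUpTo (LinearMap.ker p) rs (k + 1) := by
  intro i hi hik y hy
  -- Regularity on `G` gives `y ∈ I_i G`, and `K ∩ I_i G = I_i K` uses only the first `i ≤ k` steps
  -- of regularity on `N`; this accounts for the gain of one step.
  refine (h.mono (Nat.lt_succ_iff.1 hik)).mem_smul_top_ker p hp y (hG i hi hik y ?_)
  have hmap : Submodule.map (LinearMap.ker p).subtype (Ideal.ofList (rs.take i) • ⊤) ≤
      Ideal.ofList (rs.take i) • ⊤ := by
    rw [Submodule.map_smul'']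
    exact Submodule.smul_mono le_rfl le_top
  exact hmap ⟨_, hy, rfl⟩

end IsRegularUpTo

namespace GrMod

/-! ### The graded syzygy theorem as an induction principle -/

section Resolution

variable {Γ : Type t} [AddCommGroup Γ] [DecidableEq Γ] {S : Type u} [CommRing S]
  {𝒜 : Γ → AddSubgroup S} [GradedRing 𝒜]

/-- A finitely generated graded module on which a sequence of generators of the maximal homogeneous
ideal is regular is graded free. -/
theorem isFiniteFree_of_isRegularUpTo [IsNoetherianRing S] {rs : List S}
    (hm : IsGradedMaximal 𝒜 (Ideal.ofList rs)) (N : GrMod.{u} 𝒜) [Module.Finite S N]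
    (h : IsRegularUpTo N rs rs.length) : N.IsFiniteFree := by
  obtain ⟨n, e, p, hp, hker⟩ := exists_minimal_cover hm N
  have : Module.Finite S (free 𝒜 e) := (free_isFiniteFree 𝒜 e).finite
  have : Module.Finite S (GrMod.ker p) :=
    inferInstanceAs (Module.Finite S (LinearMap.ker p.lin))
  -- The kernel lies in `m F` because the cover is minimal, and regularity gives `K ∩ m F = m K`. So
  -- `K = m K`, and `K = 0` by Nakayama.
  have hsub : Subsingleton (GrMod.ker p) := by
    refine subsingleton_of_top_le_smul hm _ fun x _ => ?_
    have := h.mem_smul_top_ker p.lin hp x (by rw [List.take_length]; exact hker x.2)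
    rwa [List.take_length] at this
  refine isFiniteFree_of_bijective (free_isFiniteFree 𝒜 e) p ⟨?_, hp⟩
  rw [← LinearMap.ker_eq_bot, Submodule.eq_bot_iff]
  intro x hx
  exact congrArg Subtype.val (hsub.elim (⟨x, hx⟩ : LinearMap.ker p.lin) 0)

/-- Over a graded regular local ring, a property of finitely generated graded modules holds if it
holds for graded free modules and can be checked on first syzygies. -/
theorem induction_on_syzygies (hS : IsGradedRegularLocal 𝒜) (P : GrMod.{u} 𝒜 → Prop)
    (hfree : ∀ N, N.IsFiniteFree → P N)
    (hker : ∀ (F N : GrMod.{u} 𝒜) (p : F ⟶ N), F.IsFiniteFree → Function.Surjective p.lin →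
      P (GrMod.ker p) → P N) (N : GrMod.{u} 𝒜) [Module.Finite S N] : P N := by
  have := hS.isNoetherianRing
  obtain ⟨m, hmh, hmt, hmle, rs, -, hreg, rfl⟩ := hS.exists_maximal
  have hm : IsGradedMaximal 𝒜 (Ideal.ofList rs) := ⟨hmh, hmt, hmle⟩
  -- Here `k` counts the steps of regularity already available and `j` the syzygies still to be
  -- taken before the module is free.
  suffices H : ∀ (j k : ℕ), j + k = rs.length → ∀ (N : GrMod.{u} 𝒜) [Module.Finite S N],
      IsRegularUpTo N rs k → P N from
    H rs.length 0 rfl N fun i _ hi => absurd hi i.not_lt_zero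
  intro j
  induction j with
  | zero =>
    rintro k hk N _ h
    rw [zero_add] at hk
    exact hfree N (isFiniteFree_of_isRegularUpTo hm N (hk ▸ h))
  | succ j ih =>
    intro k hk N _ h
    obtain ⟨n, e, p, hp, -⟩ := exists_minimal_cover hm N
    have : Module.Finite S (free 𝒜 e) := (free_isFiniteFree 𝒜 e).finite
    have : Module.Finite S (GrMod.ker p) :=
      inferInstanceAs (Module.Finite S (LinearMap.ker p.lin))
    have : Module.Free S (free 𝒜 e) := Module.Free.of_basis (freeBasis 𝒜 e)
    exact hker _ N p (free_isFiniteFree 𝒜 e) hp (ih (k + 1) (by omega) _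
      (h.ker p.lin hp (IsRegularUpTo.of_free hreg.toIsWeaklyRegular _)))

end Resolution

end GrMod

/-! ### Nonzero homogeneous elements are nonzerodivisors -/

section Domain

variable {Γ : Type t} [AddCommGroup Γ] [DecidableEq Γ] {S : Type u} [CommRing S]
  {𝒜 : Γ → AddSubgroup S} [GradedRing 𝒜]

/-- A homogeneous element which is not in the homogeneous ideal `I` is, modulo `I`, a power of `r`
times a homogeneous element outside `I + (r)`. -/
theorem exists_sub_pow_mul_mem [IsNoetherianRing S] {m : Ideal S} (hm : IsGradedMaximal 𝒜 m)
    {I : Ideal S} (hI : I.IsHomogeneous 𝒜) {r : S} {δ : Γ} (hr : r ∈ 𝒜 δ) (hrm : r ∈ m) {a : S}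
    (ha : SetLike.IsHomogeneousElem 𝒜 a) (haI : a ∉ I) :
    ∃ (n : ℕ) (b : S), SetLike.IsHomogeneousElem 𝒜 b ∧ b ∉ I ⊔ Ideal.span {r} ∧
      a - r ^ n * b ∈ I := by
  by_contra! H
  let T : Set (Ideal S) := {J | ∃ (n : ℕ) (b : S), SetLike.IsHomogeneousElem 𝒜 b ∧
    a - r ^ n * b ∈ I ∧ J = I ⊔ Ideal.span {b}}
  -- Among all `b` with `a ≡ r ^ n * b` modulo `I`, for any `n`, one is chosen with `I + (b)`
  -- maximal. If `r` could still be divided out, giving `b ≡ r * c'`, maximality would force `I +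
  -- (c') = I + (b)`.
  obtain ⟨_, ⟨n, b, ⟨i, hb⟩, hab, rfl⟩, hmax⟩ :=
    WellFounded.has_min (wellFounded_gt (α := Ideal S)) T ⟨_, 0, a, ha, by simp, rfl⟩
  have hb' : b ∈ I ⊔ Ideal.span {r} := by
    by_contra h
    exact H n b ⟨i, hb⟩ h hab
  obtain ⟨z, hz, w, hw, hzw⟩ := Submodule.mem_sup.1 hb'
  obtain ⟨c, rfl⟩ := Ideal.mem_span_singleton'.1 hw
  let c' : S := DirectSum.decompose 𝒜 c (i - δ)
  have hc' : c' ∈ 𝒜 (i - δ) := SetLike.coe_mem _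
  -- This is the component of degree `i` of `b - c * r ∈ I`.
  have hbc : b - r * c' ∈ I := by
    have h1 := hI i hz
    rw [← eq_sub_iff_add_eq] at hzw
    have h2 := DirectSum.coe_decompose_mul_add_of_right_mem 𝒜 (a := c) (i := i - δ) hr
    rw [sub_add_cancel] at h2
    rw [hzw, DirectSum.decompose_sub, DirectSum.sub_apply, AddSubgroup.coe_sub,
      DirectSum.decompose_of_mem_same 𝒜 hb, h2, mul_comm] at h1
    exact h1
  have hac : a - r ^ (n + 1) * c' ∈ I := by
    have h : a - r ^ (n + 1) * c' = (a - r ^ n * b) + r ^ n * (b - r * c') := by ring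
    rw [h]
    exact add_mem hab (I.mul_mem_left _ hbc)
  have hle : I ⊔ Ideal.span {b} ≤ I ⊔ Ideal.span {c'} := by
    refine sup_le le_sup_left ((Ideal.span_singleton_le_iff_mem _).2 ?_)
    rw [← sub_add_cancel b (r * c')]
    exact Submodule.add_mem_sup hbc (Ideal.mul_mem_left _ _ (Ideal.mem_span_singleton_self c'))
  have hcb : c' ∈ I ⊔ Ideal.span {b} := by
    have h := hmax _ ⟨n + 1, c', ⟨_, hc'⟩, hac, rfl⟩
    rw [hle.eq_of_not_lt h]
    exact Ideal.mem_sup_right (Ideal.mem_span_singleton_self c')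
  obtain ⟨y, hy, w, hw, hyw⟩ := Submodule.mem_sup.1 hcb
  obtain ⟨s, rfl⟩ := Ideal.mem_span_singleton'.1 hw
  -- Modulo `I`, `c' ≡ s * b ≡ s * r * c'`. As `c'` is homogeneous, `1 - s * r` may be replaced by
  -- its degree-zero part, a unit because `r ∈ m`. Then `c' ∈ I`, and so `a ∈ I`.
  have hu : (1 - s * r) * c' ∈ I := by
    have h : (1 - s * r) * c' = y + s * (b - r * c') := by linear_combination -hyw
    rw [h]
    exact add_mem hy (I.mul_mem_left _ hbc)
  have hu0 := hI (0 + (i - δ)) hu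
  rw [DirectSum.coe_decompose_mul_add_of_right_mem 𝒜 hc'] at hu0
  have hunit : IsUnit (DirectSum.decompose 𝒜 (1 - s * r) 0 : S) := by
    refine hm.isUnit (SetLike.coe_mem _) fun h => hm.ne_top ((Ideal.eq_top_iff_one m).2 ?_)
    have h1 := hm.isHomogeneous 0 (m.mul_mem_left s hrm)
    rw [DirectSum.decompose_sub, DirectSum.sub_apply, AddSubgroup.coe_sub,
      DirectSum.decompose_of_mem_same 𝒜 (SetLike.GradedOne.one_mem (A := 𝒜))] at h
    simpa using add_mem h h1
  have hcI : c' ∈ I := (Ideal.unit_mul_mem_iff_mem I hunit).1 hu0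
  refine haI ?_
  have h : a = (a - r ^ (n + 1) * c') + r ^ (n + 1) * c' := by ring
  rw [h]
  exact add_mem hac (I.mul_mem_left _ hcI)

/-- Graded regular local rings are domains in the graded sense. -/
theorem IsGradedRegularLocal.eq_zero_or_eq_zero (hS : IsGradedRegularLocal 𝒜) {a b : S}
    (ha : SetLike.IsHomogeneousElem 𝒜 a) (hb : SetLike.IsHomogeneousElem 𝒜 b) (hab : a * b = 0) :
    a = 0 ∨ b = 0 := by
  have := hS.isNoetherianRing
  obtain ⟨m, hmh, hmt, hmle, rs, hrs, hreg, rfl⟩ := hS.exists_maximal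
  have hm : IsGradedMaximal 𝒜 (Ideal.ofList rs) := ⟨hmh, hmt, hmle⟩
  -- Descending induction on `k`: each ideal `(r_1, …, r_k)` is prime with respect to homogeneous
  -- elements, starting from the maximal ideal and ending at zero.
  suffices H : ∀ (j k : ℕ), j + k = rs.length → ∀ a b : S, SetLike.IsHomogeneousElem 𝒜 a →
      SetLike.IsHomogeneousElem 𝒜 b → a * b ∈ Ideal.ofList (rs.take k) →
      a ∈ Ideal.ofList (rs.take k) ∨ b ∈ Ideal.ofList (rs.take k) by
    simpa using H rs.length 0 rfl a b ha hb (by simp [hab])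
  intro j
  induction j with
  | zero =>
    rintro k hk a b ⟨i, ha⟩ ⟨i', hb⟩ hab
    rw [zero_add] at hk
    rw [hk, List.take_length] at hab ⊢
    by_contra! h
    exact hmt (Ideal.eq_top_of_isUnit_mem _ hab ((hm.isUnit ha h.1).mul (hm.isUnit hb h.2)))
  | succ j ih =>
    intro k hk a b ha hb hab
    have hk' : k < rs.length := by omega
    have hI : (Ideal.ofList (rs.take k)).IsHomogeneous 𝒜 :=
      Ideal.homogeneous_span 𝒜 _ fun x hx => hrs x (List.mem_of_mem_take hx)
    have htake : Ideal.ofList (rs.take (k + 1)) =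
        Ideal.ofList (rs.take k) ⊔ Ideal.span {rs[k]} := by
      rw [List.take_succ_eq_append_getElem hk', Ideal.ofList_append, Ideal.ofList_singleton]
    have hr : ∀ y, rs[k] * y ∈ Ideal.ofList (rs.take k) → y ∈ Ideal.ofList (rs.take k) := by
      simpa using IsRegularUpTo.of_isWeaklyRegular hreg.toIsWeaklyRegular (k + 1) k hk'
        k.lt_succ_self
    have hrp : ∀ (n : ℕ) y, rs[k] ^ n * y ∈ Ideal.ofList (rs.take k) →
        y ∈ Ideal.ofList (rs.take k) := by
      intro n
      induction n with
      | zero => simp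
      | succ n ih => exact fun y hy => ih y (hr _ (by rwa [pow_succ', mul_assoc] at hy))
    obtain ⟨δ, hδ⟩ := hrs rs[k] (List.getElem_mem hk')
    have hrm : rs[k] ∈ Ideal.ofList rs := Ideal.subset_span (List.getElem_mem hk')
    by_contra! h
    obtain ⟨n, a', ha', haI, haa⟩ := exists_sub_pow_mul_mem hm hI hδ hrm ha h.1
    obtain ⟨n', b', hb', hbI, hbb⟩ := exists_sub_pow_mul_mem hm hI hδ hrm hb h.2
    rw [← htake] at haI hbI
    -- The powers of `r` split off from `a` and `b` cancel because `r` is regular modulo the ideal.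
    -- This puts `a' * b'` in the next ideal, while neither factor is there.
    have hab' : a' * b' ∈ Ideal.ofList (rs.take k) := by
      refine hrp (n + n') _ ?_
      have h : rs[k] ^ (n + n') * (a' * b') =
          a * b - (a - rs[k] ^ n * a') * b - rs[k] ^ n * a' * (b - rs[k] ^ n' * b') := by ring
      rw [h]
      exact sub_mem (sub_mem hab (Ideal.mul_mem_right _ _ haa)) (Ideal.mul_mem_left _ _ hbb)
    rcases ih (k + 1) (by omega) a' b' ha' hb' (htake ▸ Ideal.mem_sup_left hab') with h | h
    · exact haI h
    · exact hbI h

/-- Nonzero homogeneous elements of a graded regular local ring are nonzerodivisors. -/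
theorem IsGradedRegularLocal.isSMulRegular (hS : IsGradedRegularLocal 𝒜) {f : S} {d : Γ}
    (hf : f ∈ 𝒜 d) (hf0 : f ≠ 0) : IsSMulRegular S f := by
  classical
  refine isSMulRegular_iff_right_eq_zero_of_smul.2 fun x hx => ?_
  rw [← DirectSum.sum_support_decompose 𝒜 x]
  refine Finset.sum_eq_zero fun i _ => ?_
  refine (hS.eq_zero_or_eq_zero ⟨d, hf⟩ ⟨i, SetLike.coe_mem _⟩ ?_).resolve_left hf0
  rw [← DirectSum.coe_decompose_mul_add_of_left_mem 𝒜 hf, ← smul_eq_mul, hx,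
    DirectSum.decompose_zero]
  rfl

/-- An element which is regular on the ring is regular on free modules. -/
theorem IsSMulRegular.of_basis {G ι : Type*} [AddCommGroup G] [Module S G]
    (b : Module.Basis ι S G) {f : S} (hf : IsSMulRegular S f) : IsSMulRegular G f := by
  refine fun x y h => b.ext_elem fun i => hf ?_
  simpa using DFunLike.congr_fun (congrArg b.repr h) i

end Domain

namespace GrMod

/-! ### Direct sums of graded modules and of complexes -/

section Coproduct

variable {Γ : Type t} [AddCommGroup Γ] [DecidableEq Γ] {A : Type u} [CommRing A]
  {𝒜 : Γ → AddSubgroup A}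

/-- Allowing any larger index set lets two elements share one set of degrees, as needed for sums. -/
theorem exists_forall_sum_proj (L : GrMod.{v} 𝒜) (z : L) :
    ∃ s : Finset Γ, ∀ s', s ⊆ s' → z = ∑ i ∈ s', L.proj i z := by
  obtain ⟨s, hs⟩ := L.exists_sum_proj z
  refine ⟨s, fun s' hss => ?_⟩
  conv_lhs => rw [hs]
  refine Finset.sum_subset hss fun i _ hi => ?_
  rw [hs, map_sum]
  refine Finset.sum_eq_zero fun j hj => L.proj_of_mem_ne (L.proj_mem j z) ?_
  rintro rfl
  exact hi hj

variable {I : Type v}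

/-- The direct sum of a family of graded modules. -/
def dsum (K : I → GrMod.{v} 𝒜) : GrMod.{v} 𝒜 where
  carrier := DirectSum I fun a => K a
  deg i := ⨅ a, ((K a).deg i).comap (DFinsupp.evalAddMonoidHom a)
  isInternal := by
    classical
    refine isInternal_of_proj _ (fun i => DirectSum.map fun a => (K a).proj i) ?_ ?_ ?_
    · intro i x hx
      refine DFinsupp.ext fun a => ?_
      rw [DirectSum.map_apply]
      exact (K a).proj_of_mem (AddSubgroup.mem_iInf.1 hx a)
    · intro i j x hx h
      refine DFinsupp.ext fun a => ?_
      rw [DirectSum.map_apply]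
      exact (K a).proj_of_mem_ne (AddSubgroup.mem_iInf.1 hx a) h
    · intro x
      obtain ⟨s, hs⟩ : ∃ s : Finset Γ, ∀ s', s ⊆ s' →
          x = ∑ i ∈ s', DirectSum.map (fun a => (K a).proj i) x := by
        induction x using DirectSum.induction_on with
        | zero => exact ⟨∅, fun s' _ => by simp⟩
        | of a y =>
          obtain ⟨s, hs⟩ := (K a).exists_forall_sum_proj y
          refine ⟨s, fun s' h => ?_⟩
          simp_rw [DirectSum.map_of]
          rw [← map_sum, ← hs s' h]
        | add x y hx hy =>
          obtain ⟨s, hs⟩ := hx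
          obtain ⟨s', hs'⟩ := hy
          refine ⟨s ∪ s', fun r hr => ?_⟩
          simp_rw [map_add]
          rw [Finset.sum_add_distrib, ← hs r (Finset.union_subset_left hr),
            ← hs' r (Finset.union_subset_right hr)]
      refine ⟨s, fun i => DirectSum.map (fun a => (K a).proj i) x, fun i => ?_, hs s subset_rfl⟩
      refine AddSubgroup.mem_iInf.2 fun a => ?_
      exact (K a).proj_mem i (x a)
  smul_mem ha hx := AddSubgroup.mem_iInf.2 fun a =>
    (K a).smul_mem ha (AddSubgroup.mem_iInf.1 hx a)

theorem mem_dsum_deg {K : I → GrMod.{v} 𝒜} {i : Γ} {x : DirectSum I fun a => K a} :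
    x ∈ (dsum K).deg i ↔ ∀ a, x a ∈ (K a).deg i :=
  AddSubgroup.mem_iInf

open Classical in
/-- The inclusion of a summand. -/
def dsumι (K : I → GrMod.{v} 𝒜) (a : I) : K a ⟶ dsum K where
  lin := DirectSum.lof A I (fun a => K a) a
  map_deg {i x} hx := mem_dsum_deg.2 fun b => by
    have key : DirectSum.of (fun a => K a) a x b ∈ (K b).deg i := by
      by_cases h : b = a
      · subst h
        rwa [DirectSum.of_eq_same]
      · rw [DirectSum.of_eq_of_ne _ _ _ h]
        exact zero_mem _
    exact key

/-- The projection to a summand. -/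
def dsumπ (K : I → GrMod.{v} 𝒜) (a : I) : dsum K ⟶ K a where
  lin := DirectSum.component A I (fun a => K a) a
  map_deg hx := mem_dsum_deg.1 hx a

open Classical in
/-- The morphism from a direct sum given by morphisms from the summands. -/
def dsumDesc {K : I → GrMod.{v} 𝒜} {L : GrMod.{v} 𝒜} (g : ∀ a, K a ⟶ L) : dsum K ⟶ L where
  lin := DirectSum.toModule A I L fun a => (g a).lin
  map_deg {i} x hx := by
    rw [← DirectSum.sum_support_of (x : DirectSum I fun a => K a)]
    refine (congrArg (· ∈ L.deg i) (map_sum (DirectSum.toModule A I L fun a => (g a).lin) _ _)).mpr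
      (sum_mem fun a _ => ?_)
    rw [← DirectSum.lof_eq_of A, DirectSum.toModule_lof]
    exact (g a).map_deg (mem_dsum_deg.1 hx a)

theorem dsumι_desc {K : I → GrMod.{v} 𝒜} {L : GrMod.{v} 𝒜} (g : ∀ a, K a ⟶ L) (a : I) :
    dsumι K a ≫ dsumDesc g = g a := by
  classical
  exact hom_ext fun x => DirectSum.toModule_lof A (φ := fun a => (g a).lin) a x

theorem dsumι_desc_assoc {K : I → GrMod.{v} 𝒜} {L L' : GrMod.{v} 𝒜} (g : ∀ a, K a ⟶ L) (a : I)
    (h : L ⟶ L') : dsumι K a ≫ dsumDesc g ≫ h = g a ≫ h := by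
  rw [← Category.assoc, dsumι_desc]

theorem dsum_hom_ext {K : I → GrMod.{v} 𝒜} {L : GrMod.{v} 𝒜} {g h : dsum K ⟶ L}
    (H : ∀ a, dsumι K a ≫ g = dsumι K a ≫ h) : g = h := by
  classical
  exact Hom.ext (DirectSum.linearMap_ext A fun a => congrArg Hom.lin (H a))

theorem sum_lin {M N : GrMod.{v} 𝒜} {J : Type*} (s : Finset J) (g : J → (M ⟶ N)) (x : M) :
    (∑ j ∈ s, g j).lin x = ∑ j ∈ s, (g j).lin x := by
  classical
  induction s using Finset.induction_on with
  | empty => rfl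
  | insert j s hj ih => rw [Finset.sum_insert hj, Finset.sum_insert hj, ← ih]; rfl

/-- A morphism from a finitely generated graded module to a direct sum factors through a finite
subsum. -/
theorem exists_finset_sum_dsum {K : I → GrMod.{v} 𝒜} {M : GrMod.{v} 𝒜} [Module.Finite A M]
    (g : M ⟶ dsum K) :
    ∃ s : Finset I, ∀ s', s ⊆ s' → g = ∑ a ∈ s', g ≫ dsumπ K a ≫ dsumι K a := by
  classical
  obtain ⟨T, hT⟩ := Module.Finite.fg_top (R := A) (M := M)
  let y : M → DirectSum I fun a => K a := fun x => g.lin x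
  -- The images of finitely many generators have finitely many nonzero components altogether, and
  -- two linear maps agree once they agree on generators.
  refine ⟨T.biUnion fun x => (y x).support, fun s' hs => ?_⟩
  refine Hom.ext (LinearMap.ext_on hT fun x hx => ?_)
  rw [sum_lin]
  change y x = ∑ a ∈ s', DirectSum.lof A I (fun a => K a) a (y x a)
  conv_lhs => rw [← DirectSum.sum_support_of (y x)]
  refine Finset.sum_subset ((Finset.subset_biUnion_of_mem (fun x => (y x).support) hx).trans hs)
    fun a _ ha => ?_
  rw [DFinsupp.notMem_support_iff.1 ha, map_zero]

theorem dsumι_π_self (K : I → GrMod.{v} 𝒜) (a : I) : dsumι K a ≫ dsumπ K a = 𝟙 _ := by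
  classical
  exact hom_ext fun x => DirectSum.of_eq_same (β := fun a => K a) a x

theorem dsumι_π_of_ne (K : I → GrMod.{v} 𝒜) {a b : I} (h : a ≠ b) :
    dsumι K a ≫ dsumπ K b = 0 := by
  classical
  exact hom_ext fun x => DirectSum.of_eq_of_ne (β := fun a => K a) _ _ x h.symm

/-- The direct sum of a family of morphisms. -/
def dsumMap {K L : I → GrMod.{v} 𝒜} (g : ∀ a, K a ⟶ L a) : dsum K ⟶ dsum L :=
  dsumDesc fun a => g a ≫ dsumι L a

theorem dsumι_map {K L : I → GrMod.{v} 𝒜} (g : ∀ a, K a ⟶ L a) (a : I) :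
    dsumι K a ≫ dsumMap g = g a ≫ dsumι L a :=
  dsumι_desc _ a

theorem dsumMap_desc {K L : I → GrMod.{v} 𝒜} {M : GrMod.{v} 𝒜} (g : ∀ a, K a ⟶ L a)
    (h : ∀ a, L a ⟶ M) : dsumMap g ≫ dsumDesc h = dsumDesc fun a => g a ≫ h a :=
  dsum_hom_ext fun a => by
    rw [dsumι_desc, ← Category.assoc, dsumι_map, Category.assoc, dsumι_desc]

theorem dsumDesc_comp {K : I → GrMod.{v} 𝒜} {L M : GrMod.{v} 𝒜} (g : ∀ a, K a ⟶ L) (h : L ⟶ M) :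
    dsumDesc g ≫ h = dsumDesc fun a => g a ≫ h :=
  dsum_hom_ext fun a => by rw [dsumι_desc, dsumι_desc_assoc]

theorem dsumMap_π {K L : I → GrMod.{v} 𝒜} (g : ∀ a, K a ⟶ L a) (a : I) :
    dsumMap g ≫ dsumπ L a = dsumπ K a ≫ g a :=
  dsum_hom_ext fun b => by
    rw [← Category.assoc, dsumι_map, Category.assoc, ← Category.assoc (dsumι K b)]
    by_cases h : b = a
    · subst h
      rw [dsumι_π_self, dsumι_π_self, Category.comp_id, Category.id_comp]
    · rw [dsumι_π_of_ne _ h, dsumι_π_of_ne _ h, comp_zero, zero_comp]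

theorem dsumMap_comp_eq_zero {K L M : I → GrMod.{v} 𝒜} {g : ∀ a, K a ⟶ L a} {h : ∀ a, L a ⟶ M a}
    (H : ∀ a, g a ≫ h a = 0) : dsumMap g ≫ dsumMap h = 0 :=
  dsum_hom_ext fun a => by
    rw [← Category.assoc, dsumι_map, Category.assoc, dsumι_map, ← Category.assoc, H, zero_comp,
      comp_zero]

theorem dsumMap_eq_zero {K L : I → GrMod.{v} 𝒜} {g : ∀ a, K a ⟶ L a} (H : ∀ a, g a = 0) :
    dsumMap g = 0 :=
  dsum_hom_ext fun a => by rw [dsumι_map, H, zero_comp, comp_zero]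

/-- The direct sum of a family of complexes. -/
def dsumComplex (K : I → CochainComplex (GrMod.{v} 𝒜) ℤ) : CochainComplex (GrMod.{v} 𝒜) ℤ where
  X n := dsum fun a => (K a).X n
  d i j := dsumMap fun a => (K a).d i j
  shape i j hij := dsumMap_eq_zero fun a => (K a).shape i j hij
  d_comp_d' i j k _ _ := dsumMap_comp_eq_zero fun a => (K a).d_comp_d i j k

/-- The inclusion of a summand. -/
def dsumComplexι (K : I → CochainComplex (GrMod.{v} 𝒜) ℤ) (a : I) : K a ⟶ dsumComplex K where
  f n := dsumι (fun a => (K a).X n) a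
  comm' i j _ := dsumι_map (fun a => (K a).d i j) a

/-- The projection to a summand. -/
def dsumComplexπ (K : I → CochainComplex (GrMod.{v} 𝒜) ℤ) (a : I) : dsumComplex K ⟶ K a where
  f n := dsumπ (fun a => (K a).X n) a
  comm' i j _ := (dsumMap_π (fun a => (K a).d i j) a).symm

/-- The morphism from a direct sum of complexes given by morphisms from the summands. -/
def dsumComplexDesc {K : I → CochainComplex (GrMod.{v} 𝒜) ℤ} {L : CochainComplex (GrMod.{v} 𝒜) ℤ}
    (g : ∀ a, K a ⟶ L) : dsumComplex K ⟶ L where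
  f n := dsumDesc fun a => (g a).f n
  comm' i j _ := (dsumDesc_comp (fun a => (g a).f i) (L.d i j)).trans
    ((congrArg dsumDesc (funext fun a => (g a).comm i j)).trans
      (dsumMap_desc (fun a => (K a).d i j) fun a => (g a).f j).symm)

theorem dsumComplexι_desc {K : I → CochainComplex (GrMod.{v} 𝒜) ℤ}
    {L : CochainComplex (GrMod.{v} 𝒜) ℤ} (g : ∀ a, K a ⟶ L) (a : I) :
    dsumComplexι K a ≫ dsumComplexDesc g = g a :=
  HomologicalComplex.hom_ext _ _ fun n => dsumι_desc (fun a => (g a).f n) a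

/-- A morphism from a bounded complex of finitely generated graded modules to a direct sum factors
through a finite subsum. -/
theorem exists_finset_sum_dsumComplex {K : I → CochainComplex (GrMod.{v} 𝒜) ℤ}
    {P : CochainComplex (GrMod.{v} 𝒜) ℤ} {a b : ℤ} (hab : ∀ i, i < a ∨ b < i → IsZero (P.X i))
    (hP : ∀ i, Module.Finite A (P.X i)) (g : P ⟶ dsumComplex K) :
    ∃ s : Finset I, g = ∑ i ∈ s, g ≫ dsumComplexπ K i ≫ dsumComplexι K i := by
  classical
  choose s hs using fun n => exists_finset_sum_dsum (g.f n)
  refine ⟨(Finset.Icc a b).biUnion s, HomologicalComplex.hom_ext _ _ fun n => ?_⟩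
  by_cases hn : n ∈ Finset.Icc a b
  · refine (hs n _ (Finset.subset_biUnion_of_mem s hn)).trans ?_
    exact ((HomologicalComplex.eval (GrMod.{v} 𝒜) (ComplexShape.up ℤ) n).map_sum
      (fun i => g ≫ dsumComplexπ K i ≫ dsumComplexι K i) _).symm
  · refine (hab n ?_).eq_of_src _ _
    rw [Finset.mem_Icc] at hn
    omega

end Coproduct

end GrMod

/-! ### Perfect objects: stability and smallness -/

section Perfect

open DerivedCategory

/-- Out of a K-projective complex, morphisms of the derived category are homotopy classes, and these
are represented by chain maps. -/
theorem CochainComplex.IsKProjective.Q_map_surjective {C : Type*} [Category C] [Abelian C]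
    [HasDerivedCategory C] (K L : CochainComplex C ℤ) [K.IsKProjective]
    (f : Q.obj K ⟶ Q.obj L) : ∃ g : K ⟶ L, Q.map g = f := by
  obtain ⟨g, hg⟩ := (CochainComplex.IsKProjective.Qh_map_bijective K
    ((HomotopyCategory.quotient _ _).obj L)).surjective
    ((quotientCompQhIso C).hom.app K ≫ f ≫ (quotientCompQhIso C).inv.app L)
  obtain ⟨g, rfl⟩ := (HomotopyCategory.quotient _ _).map_surjective g
  refine ⟨g, ?_⟩
  rw [← cancel_epi ((quotientCompQhIso C).hom.app K), ← quotientCompQhIso_hom_naturality, hg]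
  simp

variable {Γ : Type t} [AddCommGroup Γ] [DecidableEq Γ] {A : Type u} [CommRing A]
  {𝒜 : Γ → AddSubgroup A}

/-- A bounded above complex of projectives is K-projective. -/
theorem isKProjective_of_isFiniteFree (hA : ⨆ i, 𝒜 i = ⊤) {P : CochainComplex (GrMod.{u} 𝒜) ℤ}
    (hab : ∃ a b : ℤ, ∀ i, i < a ∨ b < i → IsZero (P.X i)) (hP : ∀ i, (P.X i).IsFiniteFree) :
    P.IsKProjective := by
  obtain ⟨a, b, hab⟩ := hab
  have : ∀ n, Projective (P.X n) := fun n => (hP n).isFree.projective hA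
  have : P.IsStrictlyLE b := (P.isStrictlyLE_iff b).2 fun i hi => hab i (Or.inr hi)
  exact CochainComplex.isKProjective_of_projective P b

variable [HasDerivedCategory.{w} (GrMod.{u} 𝒜)]

namespace IsPerfectObject

theorem of_iso {X Y : DerivedCategory (GrMod.{u} 𝒜)} (e : X ≅ Y) (hX : IsPerfectObject X) :
    IsPerfectObject Y := by
  obtain ⟨P, h, h', ⟨e'⟩⟩ := hX
  exact ⟨P, h, h', ⟨e.symm ≪≫ e'⟩⟩

theorem shift {X : DerivedCategory (GrMod.{u} 𝒜)} (hX : IsPerfectObject X) (n : ℤ) :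
    IsPerfectObject (X⟦n⟧) := by
  obtain ⟨P, ⟨a, b, hab⟩, hP, ⟨e⟩⟩ := hX
  refine ⟨P⟦n⟧, ⟨a - n, b - n, fun i hi => hab (i + n) (by omega)⟩, fun i => hP (i + n),
    ⟨(shiftFunctor _ n).mapIso e ≪≫ (Q.commShiftIso n).symm.app P⟩⟩

/-- The first morphism of the triangle is represented by a chain map of finite free complexes. Its
mapping cone, with terms `P^(i+1) ⊞ P'^i`, is again bounded and finite free, and it is isomorphic to
the third object. -/
theorem obj₃ (hA : ⨆ i, 𝒜 i = ⊤) {T : Pretriangulated.Triangle (DerivedCategory (GrMod.{u} 𝒜))}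
    (hT : T ∈ Pretriangulated.distinguishedTriangles) (h₁ : IsPerfectObject T.obj₁)
    (h₂ : IsPerfectObject T.obj₂) : IsPerfectObject T.obj₃ := by
  obtain ⟨P, ⟨a, b, hab⟩, hP, ⟨e⟩⟩ := h₁
  obtain ⟨P', ⟨a', b', hab'⟩, hP', ⟨e'⟩⟩ := h₂
  have := isKProjective_of_isFiniteFree hA ⟨a, b, hab⟩ hP
  obtain ⟨φ, hφ⟩ := CochainComplex.IsKProjective.Q_map_surjective P P' (e.inv ≫ T.mor₁ ≫ e'.hom)
  have iso : T ≅ Q.mapTriangle.obj (CochainComplex.mappingCone.triangle φ) :=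
    Pretriangulated.isoTriangleOfIso₁₂ _ _ hT (mappingCone_triangle_distinguished φ) e e' (by
      change T.mor₁ ≫ e'.hom = e.hom ≫ Q.map φ
      rw [hφ, e.hom_inv_id_assoc])
  have X : ∀ i, (CochainComplex.mappingCone φ).X i ≅ P.X (i + 1) ⊞ P'.X i := fun i =>
    HomologicalComplex.homotopyCofiber.XIsoBiprod φ i (i + 1) rfl
  refine ⟨CochainComplex.mappingCone φ, ⟨min (a - 1) a', max b b', fun i hi => ?_⟩, fun i => ?_,
    ⟨Pretriangulated.Triangle.π₃.mapIso iso⟩⟩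
  · refine IsZero.of_iso ?_ (X i)
    rw [biprod_isZero_iff]
    exact ⟨hab _ (by omega), hab' _ (by omega)⟩
  · exact GrMod.IsFiniteFree.of_iso (X i).symm ((hP _).biprod (hP' _))

theorem obj₂ (hA : ⨆ i, 𝒜 i = ⊤) {T : Pretriangulated.Triangle (DerivedCategory (GrMod.{u} 𝒜))}
    (hT : T ∈ Pretriangulated.distinguishedTriangles) (h₁ : IsPerfectObject T.obj₁)
    (h₃ : IsPerfectObject T.obj₃) : IsPerfectObject T.obj₂ :=
  obj₃ hA (Pretriangulated.inv_rot_of_distTriang _ hT) (h₃.shift (-1)) h₁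

theorem single {N : GrMod.{u} 𝒜} (hN : N.IsFiniteFree) :
    IsPerfectObject ((singleFunctor (GrMod.{u} 𝒜) 0).obj N) := by
  refine ⟨(HomologicalComplex.single (GrMod.{u} 𝒜) (ComplexShape.up ℤ) 0).obj N,
    ⟨0, 0, fun i hi => HomologicalComplex.isZero_single_obj_X _ _ _ _ (by omega)⟩, fun i => ?_,
    ⟨(singleFunctorIsoCompQ (GrMod.{u} 𝒜) 0).app N⟩⟩
  by_cases hi : i = 0
  · subst hi
    exact GrMod.IsFiniteFree.of_iso
      (HomologicalComplex.singleObjXSelf (ComplexShape.up ℤ) 0 N).symm hN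
  · exact GrMod.isFiniteFree_of_isZero (HomologicalComplex.isZero_single_obj_X _ _ _ _ hi)

/-- Every cofan in the derived category comes from a cofan of complexes. -/
theorem _root_.DerivedCategory.exists_cofan {C : Type*} [Category C] [Abelian C]
    [HasDerivedCategory C] {ι : Type*} {N : ι → DerivedCategory C} (c : Cofan N) :
    ∃ (L : CochainComplex C ℤ) (e : Q.obj L ≅ c.pt) (K : ι → CochainComplex C ℤ)
      (g : ∀ i, K i ⟶ L) (s : ∀ i, Q.obj (K i) ≅ N i),
      ∀ i, (s i).hom ≫ c.inj i = Q.map (g i) ≫ e.hom := by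
  let e := Q.objObjPreimageIso c.pt
  choose K s hs g hg using fun i =>
    right_fac ((Q.objObjPreimageIso (N i)).hom ≫ c.inj i ≫ e.inv)
  refine ⟨_, e, K, g, fun i => asIso (Q.map (s i)) ≪≫ Q.objObjPreimageIso (N i), fun i => ?_⟩
  have h := hg i
  rw [IsIso.eq_inv_comp] at h
  rw [← h]
  simp

/-- Perfect objects are small. -/
theorem isSmallObject (hA : ⨆ i, 𝒜 i = ⊤) {X : DerivedCategory (GrMod.{u} 𝒜)}
    (hX : IsPerfectObject X) : IsSmallObject.{u} X := by
  classical
  rintro ι N c ⟨hc⟩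
  have hadd : ∀ i (x : X ⟶ N i), DirectSum.toAddMonoid (β := fun i => X ⟶ N i)
      (fun i => Preadditive.rightComp X (c.inj i)) (DirectSum.of _ i x) = x ≫ c.inj i :=
    fun i x => DirectSum.toAddMonoid_of (β := fun i => X ⟶ N i)
      (fun i => Preadditive.rightComp X (c.inj i)) i x
  constructor
  -- Injectivity: the projections from the coproduct recover the components.
  · let p : ∀ j, c.pt ⟶ N j := fun j =>
      Cofan.IsColimit.desc hc fun i => if h : i = j then eqToHom (by rw [h]) else 0
    have hp : ∀ i j, c.inj i ≫ p j = if h : i = j then eqToHom (by rw [h]) else 0 :=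
      fun i j => Cofan.IsColimit.fac hc _ i
    have key : ∀ (x : DirectSum ι fun i => X ⟶ N i) (j : ι),
        DirectSum.toAddMonoid (β := fun i => X ⟶ N i)
          (fun i => Preadditive.rightComp X (c.inj i)) x ≫ p j = x j := by
      intro x j
      induction x using DirectSum.induction_on with
      | zero => rw [map_zero, zero_comp]; rfl
      | of i x =>
        rw [hadd, Category.assoc, hp]
        split_ifs with h
        · subst h
          rw [eqToHom_refl, Category.comp_id, DirectSum.of_eq_same]
        · rw [comp_zero, DirectSum.of_eq_of_ne _ _ _ (Ne.symm h)]
      | add x y hx hy => rw [map_add, Preadditive.add_comp, hx, hy]; rfl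
    intro x y h
    refine DFinsupp.ext fun j => ?_
    rw [← key x j, ← key y j, h]
  · intro z
    obtain ⟨P, ⟨a, b, hab⟩, hP, ⟨e₀⟩⟩ := hX
    have := isKProjective_of_isFiniteFree hA ⟨a, b, hab⟩ hP
    obtain ⟨L, e, K, g, s, hs⟩ := DerivedCategory.exists_cofan c
    -- It is enough that `c.pt` is a retract of the termwise direct sum, with section `φ`; the
    -- direct sum need not be known to be a coproduct in the derived category.
    let φ : c.pt ⟶ Q.obj (GrMod.dsumComplex K) :=
      Cofan.IsColimit.desc hc fun i => (s i).inv ≫ Q.map (GrMod.dsumComplexι K i)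
    have hφ : ∀ i, c.inj i ≫ φ = (s i).inv ≫ Q.map (GrMod.dsumComplexι K i) :=
      fun i => Cofan.IsColimit.fac hc _ i
    have hι : ∀ i, Q.map (GrMod.dsumComplexι K i) ≫ Q.map (GrMod.dsumComplexDesc g) ≫ e.hom =
        (s i).hom ≫ c.inj i := by
      intro i
      rw [hs, ← Category.assoc, ← Functor.map_comp, GrMod.dsumComplexι_desc]
    have hid : φ ≫ Q.map (GrMod.dsumComplexDesc g) ≫ e.hom = 𝟙 c.pt := by
      refine Cofan.IsColimit.hom_ext hc _ _ fun i => ?_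
      rw [← Category.assoc, hφ, Category.assoc, hι, Iso.inv_hom_id_assoc, Category.comp_id]
    -- The chain map `q` representing `z ≫ φ` factors through finitely many summands, and retracting
    -- to `c.pt` writes `z` as a finite sum.
    obtain ⟨q, hq⟩ := CochainComplex.IsKProjective.Q_map_surjective P (GrMod.dsumComplex K)
      (e₀.inv ≫ z ≫ φ)
    obtain ⟨T, hT⟩ := GrMod.exists_finset_sum_dsumComplex hab (fun i => (hP i).finite) q
    refine ⟨∑ i ∈ T, DirectSum.of (fun i => X ⟶ N i) i
      (e₀.hom ≫ Q.map (q ≫ GrMod.dsumComplexπ K i) ≫ (s i).hom), ?_⟩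
    rw [map_sum]
    simp_rw [hadd, Category.assoc, ← hι]
    have hz : z = e₀.hom ≫ Q.map q ≫ Q.map (GrMod.dsumComplexDesc g) ≫ e.hom := by
      rw [hq, Category.assoc, Category.assoc, hid, Category.comp_id, e₀.hom_inv_id_assoc]
    rw [hz, hT, Functor.map_sum, Preadditive.sum_comp, Preadditive.comp_sum, ← hT]
    exact Finset.sum_congr rfl fun i _ => by simp only [Functor.map_comp, Category.assoc]

end IsPerfectObject

end Perfect

/-! ### Morphisms with perfect cones -/

section Cone

open DerivedCategory Pretriangulated

variable {Γ : Type t} [AddCommGroup Γ] [DecidableEq Γ] {A : Type u} [CommRing A]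
  {𝒜 : Γ → AddSubgroup A} [HasDerivedCategory.{w} (GrMod.{u} 𝒜)]
  {X Y Z Z' : DerivedCategory (GrMod.{u} 𝒜)}

/-- Every mapping cone of the morphism `g` is perfect. -/
def HasPerfectCone (g : X ⟶ Y) : Prop :=
  ∀ T ∈ distinguishedTriangles (C := DerivedCategory (GrMod.{u} 𝒜)), ∀ (e₁ : T.obj₁ ≅ X)
    (e₂ : T.obj₂ ≅ Y), T.mor₁ ≫ e₂.hom = e₁.hom ≫ g → IsPerfectObject T.obj₃

namespace HasPerfectCone

/-- Cones are unique up to isomorphism, so a single one decides. -/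
theorem of_triangle {T : Triangle (DerivedCategory (GrMod.{u} 𝒜))}
    (hT : T ∈ distinguishedTriangles) (h : IsPerfectObject T.obj₃) : HasPerfectCone T.mor₁ :=
  fun _ hT' e₁ e₂ comm =>
    h.of_iso (Triangle.π₃.mapIso (isoTriangleOfIso₁₂ _ _ hT' hT e₁ e₂ comm)).symm

theorem isPerfectObject {g : X ⟶ Y} (hg : HasPerfectCone g) {a : Y ⟶ Z} {b : Z ⟶ X⟦(1 : ℤ)⟧}
    (hT : Triangle.mk g a b ∈ distinguishedTriangles) : IsPerfectObject Z :=
  hg _ hT (Iso.refl _) (Iso.refl _) ((Category.comp_id g).trans (Category.id_comp g).symm)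

theorem comp_iso {g : X ⟶ Y} (hg : HasPerfectCone g) (e : Y ≅ Z) : HasPerfectCone (g ≫ e.hom) :=
  fun T hT e₁ e₂ comm => hg T hT e₁ (e₂ ≪≫ e.symm) (by
    rw [Iso.trans_hom, ← Category.assoc, comm]
    simp)

theorem shift {g : X ⟶ Y} (hg : HasPerfectCone g) : HasPerfectCone (g⟦(1 : ℤ)⟧') := by
  obtain ⟨Z, a, b, hT⟩ := distinguished_cocone_triangle g
  have h : IsPerfectObject Z := hg.isPerfectObject hT
  intro T hT' e₁ e₂ comm
  -- Shifting a triangle by `1` negates its morphisms; the sign is absorbed by replacing `e₂` with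
  -- `-e₂`.
  refine of_triangle (Triangle.shift_distinguished _ hT 1) (h.shift 1) T hT' e₁ (-e₂) ?_
  change T.mor₁ ≫ (-e₂.hom) = e₁.hom ≫ (Int.negOnePow 1 • g⟦(1 : ℤ)⟧')
  rw [Int.negOnePow_one, Preadditive.comp_neg, comm]
  simp

/-- The octahedral axiom gives a triangle from the cone of `g` through the cone of `g ≫ h` to the
cone of `h`. -/
theorem comp (hA : ⨆ i, 𝒜 i = ⊤) {g : X ⟶ Y} {h : Y ⟶ Z} (hg : HasPerfectCone g)
    (hh : HasPerfectCone h) : HasPerfectCone (g ≫ h) := by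
  obtain ⟨_, _, _, h₁₂⟩ := distinguished_cocone_triangle g
  obtain ⟨_, _, _, h₂₃⟩ := distinguished_cocone_triangle h
  obtain ⟨_, _, _, h₁₃⟩ := distinguished_cocone_triangle (g ≫ h)
  exact of_triangle h₁₃ (IsPerfectObject.obj₂ hA (Triangulated.someOctahedron rfl h₁₂ h₂₃ h₁₃).mem
    (hg.isPerfectObject h₁₂) (hh.isPerfectObject h₂₃))

/-- Rotating twice makes the connecting map the first morphism of a triangle, with cone `T.X₂[1]`.
-/
theorem singleδ {T : ShortComplex (GrMod.{u} 𝒜)} (hT : T.ShortExact)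
    (h : IsPerfectObject ((singleFunctor (GrMod.{u} 𝒜) 0).obj T.X₂)) :
    HasPerfectCone hT.singleδ :=
  of_triangle (rot_of_distTriang _ (rot_of_distTriang _ hT.singleTriangle_distinguished))
    (h.shift 1)

end HasPerfectCone

end Cone

/-- Two Yoneda composites agree when a map `κ` of the middle objects, with identities at both ends,
relates their factors: `κ` slides from one factor to the other. -/
theorem shiftedHom_comp_eq {C : Type*} [Category C] [HasShift C ℤ] {X Y Q Q' : C}
    {κ : Q' ⟶ Q} {a b c : ℤ} {α : ShiftedHom X Q a} {β : ShiftedHom Q Y b} {α' : ShiftedHom X Q' a}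
    {β' : ShiftedHom Q' Y b} (hβ : κ ≫ β = β') (hα : α' ≫ κ⟦a⟧' = α) (h : b + a = c) :
    ShiftedHom.comp α β h = ShiftedHom.comp α' β' h := by
  subst hβ hα
  simp [ShiftedHom.comp]

namespace GrMod

theorem shortExact_of_lin {Γ : Type t} [AddCommGroup Γ] [DecidableEq Γ] {A : Type u} [CommRing A]
    {𝒜 : Γ → AddSubgroup A} (T : ShortComplex (GrMod.{v} 𝒜)) (hf : Function.Injective T.f.lin)
    (hfg : ∀ x, T.g.lin x = 0 → ∃ y, T.f.lin y = x) (hg : Function.Surjective T.g.lin) :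
    T.ShortExact := by
  have : Mono T.f := mono_of_injective _ hf
  have : Epi T.g := epi_of_surjective _ hg
  refine ShortComplex.ShortExact.mk ?_
  rw [T.exact_iff_of_forks (kerIsLimit T.g) (cokerIsColimit T.f)]
  exact hom_ext fun x => (Submodule.Quotient.mk_eq_zero _).2 (hfg _ x.2)

/-! ### Reduction modulo `f` and the four-term sequence -/

section Hypersurface

variable {Γ : Type t} [AddCommGroup Γ] [DecidableEq Γ] {S : Type u} [CommRing S]
  {𝒜 : Γ → AddSubgroup S} {f : S} {d : Γ} (hf : f ∈ 𝒜 d)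

/-- The class in `F/fF` of an element of `F`. -/
def redMk (F : GrMod.{v} 𝒜) : F →+ red hf F :=
  (Ideal.span {f} • ⊤ : Submodule S F).mkQ.toAddMonoidHom

theorem redMk_surjective (F : GrMod.{v} 𝒜) : Function.Surjective (redMk hf F) :=
  (Ideal.span {f} • ⊤ : Submodule S F).mkQ_surjective

theorem redMk_eq_zero {F : GrMod.{v} 𝒜} {x : F} : redMk hf F x = 0 ↔ ∃ y : F, f • y = x :=
  (Submodule.Quotient.mk_eq_zero _).trans mem_span_smul_top

theorem redMk_smul {F : GrMod.{v} 𝒜} (a : S) (x : F) :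
    redMk hf F (a • x) = Ideal.Quotient.mk (Ideal.span {f}) a • redMk hf F x := rfl

theorem redMk_mem {F : GrMod.{v} 𝒜} {i : Γ} {x : F} (hx : x ∈ F.deg i) :
    redMk hf F x ∈ (red hf F).deg i :=
  ⟨x, hx, rfl⟩

theorem redMap_comp {F G H : GrMod.{v} 𝒜} (φ : F ⟶ G) (ψ : G ⟶ H) :
    redMap hf φ ≫ redMap hf ψ = redMap hf (φ ≫ ψ) :=
  hom_ext fun x => by
    obtain ⟨x, rfl⟩ := redMk_surjective hf F x
    rfl

/-- The classes of a homogeneous basis stay independent because the coordinates of an element of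
`fF` are multiples of `f`. -/
theorem IsFiniteFree.red {F : GrMod.{v} 𝒜} (hF : F.IsFiniteFree) : (red hf F).IsFiniteFree := by
  obtain ⟨n, b, hb⟩ := hF
  have hli : LinearIndependent (S ⧸ Ideal.span {f}) fun i => redMk hf F (b i) := by
    rw [Fintype.linearIndependent_iff]
    intro c hc i
    choose a ha using fun i => Ideal.Quotient.mk_surjective (c i)
    have h : redMk hf F (∑ i, a i • b i) = 0 := by
      rw [map_sum, ← hc]
      exact Finset.sum_congr rfl fun i _ => by rw [redMk_smul, ha]
    obtain ⟨y, hy⟩ := (redMk_eq_zero hf).1 h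
    have hi := DFunLike.congr_fun (congrArg b.repr hy) i
    rw [b.repr_sum_self, map_smul, Finsupp.smul_apply, smul_eq_mul] at hi
    rw [← ha, Ideal.Quotient.eq_zero_iff_mem, ← hi]
    exact Ideal.mul_mem_right _ _ (Ideal.mem_span_singleton_self f)
  have hsp : ⊤ ≤ Submodule.span (S ⧸ Ideal.span {f}) (Set.range fun i => redMk hf F (b i)) := by
    intro x _
    obtain ⟨x, rfl⟩ := redMk_surjective hf F x
    rw [← b.sum_repr x, map_sum]
    refine Submodule.sum_mem _ fun i _ => ?_
    rw [redMk_smul]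
    exact Submodule.smul_mem _ _ (Submodule.subset_span ⟨i, rfl⟩)
  refine ⟨n, Module.Basis.mk hli hsp, fun i => ?_⟩
  obtain ⟨j, hj⟩ := hb i
  exact ⟨j, by rw [Module.Basis.mk_apply]; exact redMk_mem hf hj⟩

/-- Reduction modulo `f` of a short exact sequence `0 ⟶ ker p ⟶ F ⟶ N ⟶ 0` such that `f` is regular
on `N`. -/
theorem shortExact_red {F N : GrMod.{v} 𝒜} (p : F ⟶ N) (hp : Function.Surjective p.lin)
    (hN : IsSMulRegular N f) :
    (ShortComplex.mk (redMap hf (kerι p)) (redMap hf p) (by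
      rw [redMap_comp]
      refine hom_ext fun x => ?_
      obtain ⟨x, rfl⟩ := redMk_surjective hf _ x
      exact congrArg (redMk hf N) x.2)).ShortExact := by
  refine shortExact_of_lin _ ?_ ?_ ?_
  · refine (injective_iff_map_eq_zero (redMap hf (kerι p)).lin).2 fun x hx => ?_
    obtain ⟨x, rfl⟩ := redMk_surjective hf _ x
    obtain ⟨y, hy⟩ := (redMk_eq_zero hf).1 hx
    refine (redMk_eq_zero hf).2 ⟨⟨y, ?_⟩, Subtype.ext hy⟩
    -- If `x = f y` with `x ∈ ker p`, then `f • p y = 0`, so `y ∈ ker p` by regularity on `N`: this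
    -- is the vanishing of `Tor₁`.
    refine isSMulRegular_iff_right_eq_zero_of_smul.1 hN _ ?_
    rw [← map_smul, hy]
    exact x.2
  · intro x hx
    obtain ⟨x, rfl⟩ := redMk_surjective hf _ x
    obtain ⟨y, hy⟩ := (redMk_eq_zero hf).1 hx
    obtain ⟨z, rfl⟩ := hp y
    refine ⟨redMk hf _ ⟨x - f • z, ?_⟩, ?_⟩
    · rw [LinearMap.mem_ker, map_sub, map_smul, hy]
      exact sub_self _
    · change redMk hf F (x - f • z) = redMk hf F x
      rw [map_sub, (redMk_eq_zero hf).2 ⟨z, rfl⟩, sub_zero]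
  · intro x
    obtain ⟨x, rfl⟩ := redMk_surjective hf _ x
    obtain ⟨y, rfl⟩ := hp x
    exact ⟨redMk hf F y, rfl⟩

/-- If `f` is regular on the finitely generated graded module `N` over a graded regular local ring
then `N/fN` is perfect. -/
theorem isPerfectObject_red [GradedRing 𝒜] (hS : IsGradedRegularLocal 𝒜) (hf0 : f ≠ 0)
    [HasDerivedCategory.{w} (GrMod.{u} (quotGrading 𝒜 f))] (N : GrMod.{u} 𝒜) [Module.Finite S N]
    (hN : IsSMulRegular N f) :
    IsPerfectObject ((DerivedCategory.singleFunctor _ 0).obj (red hf N)) := by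
  induction N using induction_on_syzygies hS with
  | hfree N hN' => exact IsPerfectObject.single (hN'.red hf)
  | hker F N p hF hp ih =>
    have hF' : IsSMulRegular F f := by
      obtain ⟨n, b, -⟩ := hF
      exact (hS.isSMulRegular hf hf0).of_basis b
    -- The syzygy is a submodule of the free module `F`, so `f` is regular on it too and the
    -- induction hypothesis applies.
    exact IsPerfectObject.obj₃ (iSup_quotGrading 𝒜 f)
      (shortExact_red hf p hp hN).singleTriangle_distinguished
      (ih fun x y h => Subtype.ext (hF' (congrArg Subtype.val h)))
      (IsPerfectObject.single (hF.red hf))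

variable {M : GrMod.{v} (quotGrading 𝒜 f)} {F : GrMod.{v} 𝒜} (π : F ⟶ M.restrict)

theorem torMap_apply_redMk (hπ : Function.Surjective π.lin) (x : F) (h : π.lin (f • x) = 0) :
    (torMap hf π hπ).lin (π.lin x) = redMk hf (ker π) ⟨f • x, h⟩ :=
  torMap_apply hf π hπ x

/-- Regularity on `F` serves for injectivity: `f x ∈ fK` forces `x ∈ K`. Exactness in the middle
says that an element of `K ∩ fF` has the form `f x`, so its class is the image of `π x`. -/
theorem leftSeq_shortExact (hπ : Function.Surjective π.lin) (hF : IsSMulRegular F f) :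
    (leftSeq hf π hπ).ShortExact := by
  have hfx : ∀ x, π.lin (f • x) = 0 := fun x => by rw [map_smul, restrict_smul_eq_zero]
  refine shortExact_of_lin _ ?_ ?_ ?_
  · refine (injective_iff_map_eq_zero (torMap hf π hπ).lin).2 fun m hm => ?_
    obtain ⟨x, rfl⟩ := hπ m
    rw [torMap_apply_redMk hf π hπ x (hfx x)] at hm
    obtain ⟨y, hy⟩ := (redMk_eq_zero hf).1 hm
    rw [← hF (congrArg Subtype.val hy)]
    exact y.2
  · intro k hk
    obtain ⟨k, rfl⟩ := redMk_surjective hf _ k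
    obtain ⟨x, hx⟩ := (redMk_eq_zero hf (F := F)).1 (congrArg Subtype.val hk)
    refine ⟨π.lin x, (torMap_apply_redMk hf π hπ x (hfx x)).trans ?_⟩
    exact congrArg (redMk hf (ker π)) (Subtype.ext hx)
  · rintro ⟨x, hx⟩
    obtain ⟨x, rfl⟩ := redMk_surjective hf _ x
    exact ⟨redMk hf (ker π) ⟨x, hx⟩, rfl⟩

theorem rightSeq_shortExact (hπ : Function.Surjective π.lin) : (rightSeq hf π).ShortExact := by
  refine shortExact_of_lin _ Subtype.val_injective (fun x hx => ⟨⟨x, hx⟩, rfl⟩) fun m => ?_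
  obtain ⟨x, rfl⟩ := hπ m
  exact ⟨redMk hf F x, rfl⟩

variable {F' : GrMod.{v} 𝒜} (π' : F' ⟶ M.restrict) (φ : F' ⟶ F)

theorem redMap_redAug (hφ : φ ≫ π = π') : redMap hf φ ≫ redAug hf π = redAug hf π' := by
  subst hφ
  refine hom_ext fun x => ?_
  obtain ⟨x, rfl⟩ := redMk_surjective hf _ x
  rfl

/-- The morphism of kernels induced by a morphism over `M`. -/
def kerMap (hφ : φ ≫ π = π') : ker π' ⟶ ker π :=
  kerLift π (kerι π' ≫ φ) (by
    rw [Category.assoc, hφ]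
    exact hom_ext fun x => x.2)

/-- The morphism `ker (F'/fF' ⟶ M) ⟶ ker (F/fF ⟶ M)` induced by a morphism over `M`. -/
def kerRedMap (hφ : φ ≫ π = π') : ker (redAug hf π') ⟶ ker (redAug hf π) :=
  kerLift _ (kerι _ ≫ redMap hf φ) (by
    rw [Category.assoc, redMap_redAug hf π π' φ hφ]
    exact hom_ext fun x => x.2)

/-- Functoriality of `leftSeq`. -/
def leftSeqMap (hφ : φ ≫ π = π') (hπ : Function.Surjective π.lin)
    (hπ' : Function.Surjective π'.lin) : leftSeq hf π' hπ' ⟶ leftSeq hf π hπ where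
  τ₁ := 𝟙 _
  τ₂ := redMap hf (kerMap π π' φ hφ)
  τ₃ := kerRedMap hf π π' φ hφ
  comm₁₂ := hom_ext fun m => by
    obtain ⟨x, rfl⟩ := hπ' m
    have hx : π'.lin x = π.lin (φ.lin x) := by rw [← hφ]; rfl
    have h := torMap_apply_redMk hf π hπ (φ.lin x) (by rw [map_smul, restrict_smul_eq_zero])
    have h' := torMap_apply_redMk hf π' hπ' x (by rw [map_smul, restrict_smul_eq_zero])
    change (torMap hf π hπ).lin (π'.lin x) =
      (redMap hf (kerMap π π' φ hφ)).lin ((torMap hf π' hπ').lin (π'.lin x))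
    rw [h']
    refine (congrArg (torMap hf π hπ).lin hx).trans (h.trans ?_)
    exact congrArg (redMk hf (ker π)) (Subtype.ext (map_smul φ.lin f x).symm)
  comm₂₃ := hom_ext fun k => by
    obtain ⟨k, rfl⟩ := redMk_surjective hf _ k
    rfl

/-- Functoriality of `rightSeq`. -/
def rightSeqMap (hφ : φ ≫ π = π') : rightSeq hf π' ⟶ rightSeq hf π where
  τ₁ := kerRedMap hf π π' φ hφ
  τ₂ := redMap hf φ
  τ₃ := 𝟙 _
  comm₁₂ := rfl
  comm₂₃ := (redMap_redAug hf π π' φ hφ).trans (Category.comp_id _).symm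

/-- The operator `χ_f` does not depend on the choice of the free cover. -/
theorem chi_eq [HasDerivedCategory.{w} (GrMod.{v} (quotGrading 𝒜 f))] (hφ : φ ≫ π = π')
    {hπ : Function.Surjective π.lin} {hπ' : Function.Surjective π'.lin}
    (h₁ : (leftSeq hf π hπ).ShortExact) (h₂ : (rightSeq hf π).ShortExact)
    (h₁' : (leftSeq hf π' hπ').ShortExact) (h₂' : (rightSeq hf π').ShortExact) :
    chi hf π h₁ h₂ = chi hf π' h₁' h₂' := by
  -- The induced maps of triangles are the identity on `Σ^d M` for the left half and on `M` for the
  -- right half, so their last squares say that both pairs of connecting maps differ only by the map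
  -- of middle kernels.
  have c₁ : (DerivedCategory.singleFunctor _ 0).map (kerRedMap hf π π' φ hφ) ≫ h₁.singleδ =
      h₁'.singleδ := by
    refine ((ShortComplex.ShortExact.singleTriangle.map h₁' h₁
      (leftSeqMap hf π π' φ hφ hπ hπ')).comm₃).symm.trans ?_
    have h : ((DerivedCategory.singleFunctor _ 0).map (𝟙 (leftSeq hf π' hπ').X₁))⟦(1 : ℤ)⟧' =
        𝟙 _ := by
      rw [CategoryTheory.Functor.map_id, CategoryTheory.Functor.map_id]
    exact (congrArg (h₁'.singleδ ≫ ·) h).trans (Category.comp_id _)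
  have c₂ : h₂'.singleδ ≫
      ((DerivedCategory.singleFunctor _ 0).map (kerRedMap hf π π' φ hφ))⟦(1 : ℤ)⟧' =
      h₂.singleδ := by
    refine (ShortComplex.ShortExact.singleTriangle.map h₂' h₂
      (rightSeqMap hf π π' φ hφ)).comm₃.trans ?_
    have h := (DerivedCategory.singleFunctor _ 0).map_id (rightSeq hf π).X₃
    exact (congrArg (· ≫ h₂.singleδ) h).trans (Category.id_comp _)
  exact shiftedHom_comp_eq c₁ c₂ _

end Hypersurface

end GrMod

/-! ### Perfection of the cone of `χ_f` -/

namespace GrMod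

/-- The mapping cones of `χ_f` are perfect. -/
theorem hasPerfectCone_chi {Γ : Type t} [AddCommGroup Γ] [DecidableEq Γ] {S : Type u} [CommRing S]
    {𝒜 : Γ → AddSubgroup S} [GradedRing 𝒜] (hS : IsGradedRegularLocal 𝒜) {f : S} {d : Γ}
    (hf : f ∈ 𝒜 d) (hf0 : f ≠ 0) [HasDerivedCategory.{w} (GrMod.{u} (quotGrading 𝒜 f))]
    {M : GrMod.{u} (quotGrading 𝒜 f)} (hM : Module.Finite (S ⧸ Ideal.span {f}) M) {F : GrMod.{u} 𝒜}
    (π : F ⟶ M.restrict) (hπ : Function.Surjective π.lin)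
    (h₁ : (leftSeq hf π hπ).ShortExact) (h₂ : (rightSeq hf π).ShortExact) :
    HasPerfectCone (chi hf π h₁ h₂) := by
  have hreg := hS.isSMulRegular hf hf0
  have := hS.isNoetherianRing
  have hA := iSup_quotGrading 𝒜 f
  have hM' : Module.Finite S M.restrict := by
    obtain ⟨s, hs⟩ := hM.fg_top
    refine ⟨⟨s, eq_top_iff.2 fun x _ => ?_⟩⟩
    have hx : (x : M) ∈ Submodule.span (S ⧸ Ideal.span {f}) (s : Set M) := hs ▸ trivial
    induction hx using Submodule.span_induction with
    | mem x hx => exact Submodule.subset_span hx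
    | zero => exact zero_mem _
    | add x y _ _ h h' => exact add_mem (h trivial) (h' trivial)
    | smul a x _ h =>
      obtain ⟨a, rfl⟩ := Ideal.Quotient.mk_surjective a
      exact Submodule.smul_mem _ a (h trivial)
  -- The given `F` may have infinite rank, so a finite graded free cover replaces it; its kernel is
  -- finitely generated since `S` is Noetherian.
  obtain ⟨n, y, hy, hspan⟩ := M.restrict.exists_homogeneous_generators
  choose e he using hy
  let π' := freeHom 𝒜 y he
  have hπ' : Function.Surjective π'.lin := freeHom_surjective y he hspan
  have hfree : (free 𝒜 e).IsFiniteFree := free_isFiniteFree 𝒜 e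
  have : Module.Finite S (free 𝒜 e) := hfree.finite
  have : Module.Finite S (ker π') := inferInstanceAs (Module.Finite S (LinearMap.ker π'.lin))
  have hF' : IsSMulRegular (free 𝒜 e) f := hreg.of_basis (freeBasis 𝒜 e)
  have : Projective (free 𝒜 e) := hfree.isFree.projective (iSup_grading 𝒜)
  have : Epi π := epi_of_surjective π hπ
  have h₁' := leftSeq_shortExact hf π' hπ' hF'
  have h₂' := rightSeq_shortExact hf π' hπ'
  -- The finite cover is projective, so it lifts through the epimorphism `π`, which is the
  -- comparison `chi_eq` asks for.
  rw [chi_eq hf π π' (Projective.factorThru π' π) (Projective.factorThru_comp π' π) h₁ h₂ h₁' h₂']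
  have c₁ : HasPerfectCone h₁'.singleδ := HasPerfectCone.singleδ h₁'
    (isPerfectObject_red hf hS hf0 (ker π') fun x y h => Subtype.ext (hF' (congrArg Subtype.val h)))
  have c₂ : HasPerfectCone h₂'.singleδ :=
    HasPerfectCone.singleδ h₂' (IsPerfectObject.single (hfree.red hf))
  -- The isomorphism identifies `[1][1]` with `[2]`, as in the definition of composition of shifted
  -- morphisms.
  exact c₂.comp hA (c₁.shift.comp_iso ((shiftFunctorAdd' _ (1 : ℤ) 1 2 (by norm_num)).symm.app _))

end GrMod

end

theorem mainTheorem12 {Γ : Type t} [AddCommGroup Γ] [DecidableEq Γ] {S : Type u} [CommRing S]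
    (𝒜 : Γ → AddSubgroup S) [GradedRing 𝒜] (hS : IsGradedRegularLocal 𝒜)
    {f : S} {d : Γ} (hf : f ∈ 𝒜 d) (hf0 : f ≠ 0)
    [HasDerivedCategory.{w} (GrMod.{u} (GrMod.quotGrading 𝒜 f))]
    (M : GrMod.{u} (GrMod.quotGrading 𝒜 f)) (hM : Module.Finite (S ⧸ Ideal.span {f}) M)
    (F : GrMod.{u} 𝒜) (hF : F.IsFree) (π : F ⟶ M.restrict) (hπ : Function.Surjective π.lin) :
    ∃ (h₁ : (GrMod.leftSeq hf π hπ).ShortExact) (h₂ : (GrMod.rightSeq hf π).ShortExact),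
      ∀ (C : DerivedCategory (GrMod.{u} (GrMod.quotGrading 𝒜 f)))
        (g : ((DerivedCategory.singleFunctor _ 0).obj (M.susp d))⟦(2 : ℤ)⟧ ⟶ C)
        (h : C ⟶ ((DerivedCategory.singleFunctor _ 0).obj M)⟦(1 : ℤ)⟧),
        Pretriangulated.Triangle.mk (GrMod.chi hf π h₁ h₂) g h ∈
            Pretriangulated.distinguishedTriangles →
          IsSmallObject.{u} C ∧ IsPerfectObject C := by
  have hreg := hS.isSMulRegular hf hf0
  have hF' : IsSMulRegular F f := by
    obtain ⟨ι, b, -⟩ := hF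
    exact hreg.of_basis b
  refine ⟨GrMod.leftSeq_shortExact hf π hπ hF', GrMod.rightSeq_shortExact hf π hπ,
    fun C g h hT => ?_⟩
  have hC := (GrMod.hasPerfectCone_chi hS hf hf0 hM π hπ _ _).isPerfectObject hT
  exact ⟨hC.isSmallObject (GrMod.iSup_quotGrading 𝒜 f), hC⟩
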